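/- **Setting.** There are $K$ arms. Pulling arm $i$ at time $t=1,2,\dots$ gives the reward $Y_{i,t}\in[0,1]$; for each arm the rewards are i.i.d. over time with mean $\mu_i$, and the reward vectors $(Y_{1,t},\dots,Y_{K,t})$ of different times are independent. Assume $\mu_1>\mu_i$ for all $i\ge 2$ and put $\Delta_i=\mu_1-\mu_i$. Let $A_t$ be the arm played at time $t$, $N_i(T)=\sum_{t=1}^T \mathbf 1(A_t=i)$, and $\mathbb E[R(T)]=\sum_{i=2}^K\Delta_i\,\mathbb E[N_i(T)]$. **Batched Thompson sampling** with Gaussian variance $\sigma^2$ ($\sigma>0$) and batch growth factor $\alpha>1$. *Cycles:* the first cycle begins at time $1$, each further cycle begins right after the end of the previous one, and a cycle that begins at time $s$ ends at the first time $t>s$ with $A_t\ne A_{t-1}$. Let $M_i(t)$ be the number of times $s\le t$ that are the beginning or the end of a cycle and at which $A_s=i$, and let $S_i(t)$ be the sum of the rewards $Y_{i,s}$ over these times. *Batches:* $T_0=0$, and the $j$-th batch ends at the first time $T_j>T_{j-1}$ that is the end of a cycle and at which $M_i(T_j)=\max\{1,\lceil\alpha M_i(T_{j-1})\rceil\}$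 for some arm $i$. *Actions:* at each time $t$ of the $j$-th batch the policy draws, independently over arms and with fresh randomness independent of the past and of the rewards, $$\theta_i(t)\sim\mathcal N\Big(\frac{S_i(T_{j-1})}{1+M_i(T_{j-1})},\ \frac{\sigma^2}{1+M_i(T_{j-1})}\Big),$$ and plays $A_t\in\arg\max_i\theta_i(t)$ (ties are broken arbitrarily). **Theorem.** There are absolute constants $C_1,C_2\ge 1$ such that for all $K$, all reward distributions as above, all $\sigma>0$ and $\alpha$ with $1<\alpha\le \frac{5\sigma^2}{4}$, and all integers $T\ge 2$, Batched Thompson sampling satisfies $$\mathbb E[N_i(T)]\le C_1\alpha\sigma^2\frac{\log T}{\Delta_i^2}\quad\text{for every } i\ge 2,$$ $$\mathbb E[R(T)]\le C_1\alpha\sigma^2\sum_{i=2}^K\frac{\log T}{\Delta_i},\qquad\text{and}\qquad \mathbb E[R(T)]\le C_2\,\sigma\sqrt{\alpha K T\log T}.$$ -/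

import Mathlib

open MeasureTheory ProbabilityTheory

namespace BatchedTS

variable {K : ℕ}

/-! Time steps are `1, 2, 3, …`. An action sequence is a function `a : ℕ → Fin K`, a reward table
`y : ℕ → Fin K → ℝ` and a noise table `z : ℕ → Fin K → ℝ`; their values at time `0` play no role. -/

/-- The first time step of the cycle that contains time `t`. A cycle starts at time `1` or right
after the end of the previous cycle, and it ends at the first time `t` after its start at which
the action differs from the previous one. -/
def cycleStart (a : ℕ → Fin K) : ℕ → ℕ
  | 0 => 1
  | t + 1 => if cycleStart a t < t ∧ a t ≠ a (t - 1) then t + 1 else cycleStart a t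

/-- `t` is the beginning of some cycle. -/
def IsCycleBegin (a : ℕ → Fin K) (t : ℕ) : Prop := cycleStart a t = t

/-- `t` is the end of some cycle. -/
def IsCycleEnd (a : ℕ → Fin K) (t : ℕ) : Prop := cycleStart a t < t ∧ a t ≠ a (t - 1)

instance (a : ℕ → Fin K) (t : ℕ) : Decidable (IsCycleBegin a t) := by
  unfold IsCycleBegin; infer_instance

instance (a : ℕ → Fin K) (t : ℕ) : Decidable (IsCycleEnd a t) := by
  unfold IsCycleEnd; infer_instance

/-- The times `s ≤ t` at which arm `i` is played at the beginning or at the end of a cycle. -/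
def recordedTimes (a : ℕ → Fin K) (i : Fin K) (t : ℕ) : Finset ℕ :=
  (Finset.Icc 1 t).filter fun s => a s = i ∧ (IsCycleBegin a s ∨ IsCycleEnd a s)

/-- The cycle count `M_i(t)`. -/
def cycleCount (a : ℕ → Fin K) (i : Fin K) (t : ℕ) : ℕ := (recordedTimes a i t).card

/-- The recorded cumulative reward `S_i(t)`. -/
noncomputable def recordedReward (y : ℕ → Fin K → ℝ) (a : ℕ → Fin K) (i : Fin K) (t : ℕ) : ℝ :=
  ∑ s ∈ recordedTimes a i t, y s i

/-- The upper limit on the cycle count of arm `i` in a batch that starts right after the batch end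
point `s`, namely `max {1, ⌈α M_i(s)⌉}`. -/
noncomputable def upperLimit (α : ℝ) (a : ℕ → Fin K) (i : Fin K) (s : ℕ) : ℕ :=
  max 1 ⌈α * (cycleCount a i s : ℝ)⌉₊

/-- The largest batch end point that is at most `t` (the point `0` is a batch end point). A time
is a batch end point if it ends a cycle and the cycle count of some arm equals its upper limit for
the current batch, set at the preceding batch end point. -/
noncomputable def lastBatchEnd (α : ℝ) (a : ℕ → Fin K) : ℕ → ℕ
  | 0 => 0
  | t + 1 =>
    if IsCycleEnd a (t + 1) ∧
        ∃ i : Fin K, cycleCount a i (t + 1) = upperLimit α a i (lastBatchEnd α a t)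
    then t + 1 else lastBatchEnd α a t

/-- The sample `θ_i(t)` for arm `i` at time `t`: it is Gaussian with mean `S_i(s) / (1 + M_i(s))`
and variance `σ² / (1 + M_i(s))`, where `s` is the last batch end point before `t`, and `z t i`
is the standard Gaussian that generates it. -/
noncomputable def sample (α σ : ℝ) (y z : ℕ → Fin K → ℝ) (a : ℕ → Fin K) (t : ℕ) (i : Fin K) : ℝ :=
  recordedReward y a i (lastBatchEnd α a (t - 1)) /
      (1 + (cycleCount a i (lastBatchEnd α a (t - 1)) : ℝ)) +
    σ / √(1 + (cycleCount a i (lastBatchEnd α a (t - 1)) : ℝ)) * z t i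

/-- `sel` is a (measurable) argmax rule: it maps a vector to a coordinate where the largest value
is attained. Ties are broken arbitrarily. -/
structure IsArgmax (sel : (Fin K → ℝ) → Fin K) : Prop where
  measurable : Measurable sel
  le : ∀ (v : Fin K → ℝ) (i : Fin K), v i ≤ v (sel v)

/-- The action sequence of Batched Thompson sampling, determined up to time `t`. The action at
time `t + 1` is the argmax of the samples, which depend only on the actions up to time `t`. -/
noncomputable def run (sel : (Fin K → ℝ) → Fin K) (α σ : ℝ) (y z : ℕ → Fin K → ℝ) :
    ℕ → ℕ → Fin K
  | 0 => fun _ => sel 0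
  | t + 1 => Function.update (run sel α σ y z t) (t + 1)
      (sel (sample α σ y z (run sel α σ y z t) (t + 1)))

/-- The action `A_t` that Batched Thompson sampling plays at time `t`. -/
noncomputable def action (sel : (Fin K → ℝ) → Fin K) (α σ : ℝ) (y z : ℕ → Fin K → ℝ)
    (t : ℕ) : Fin K :=
  run sel α σ y z t t

lemma run_eq_action (sel : (Fin K → ℝ) → Fin K) (α σ : ℝ) (y z : ℕ → Fin K → ℝ) (t s : ℕ)
    (h : s ≤ t) : run sel α σ y z t s = action sel α σ y z s := by
  induction t with
  | zero => obtain rfl : s = 0 := by omega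
            rfl
  | succ t ih =>
    rcases Nat.lt_or_ge t s with h' | h'
    · obtain rfl : s = t + 1 := by omega
      rfl
    · rw [← ih h', run, Function.update_of_ne (by omega)]

lemma cycleStart_congr {a b : ℕ → Fin K} (t : ℕ) (h : ∀ s < t, a s = b s) :
    cycleStart a t = cycleStart b t := by
  induction t with
  | zero => rfl
  | succ t ih =>
    rw [cycleStart, cycleStart, ih fun s hs => h s (by omega), h t (by omega),
      h (t - 1) (by omega)]

lemma isCycleEnd_congr {a b : ℕ → Fin K} (t : ℕ) (h : ∀ s ≤ t, a s = b s) :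
    IsCycleEnd a t ↔ IsCycleEnd b t := by
  rw [IsCycleEnd, IsCycleEnd, cycleStart_congr t fun s hs => h s hs.le, h t le_rfl,
    h (t - 1) (by omega)]

lemma recordedTimes_congr {a b : ℕ → Fin K} (i : Fin K) (t : ℕ) (h : ∀ s ≤ t, a s = b s) :
    recordedTimes a i t = recordedTimes b i t := by
  refine Finset.filter_congr fun s hs => ?_
  have hs' := (Finset.mem_Icc.1 hs).2
  rw [isCycleEnd_congr s fun u hu => h u (hu.trans hs'), h s hs', IsCycleBegin, IsCycleBegin,
    cycleStart_congr s fun u hu => h u (hu.le.trans hs')]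

lemma lastBatchEnd_le (α : ℝ) (a : ℕ → Fin K) (t : ℕ) : lastBatchEnd α a t ≤ t := by
  induction t with
  | zero => exact le_rfl
  | succ t ih => rw [lastBatchEnd]; split_ifs <;> omega

lemma lastBatchEnd_congr (α : ℝ) {a b : ℕ → Fin K} (t : ℕ) (h : ∀ s ≤ t, a s = b s) :
    lastBatchEnd α a t = lastBatchEnd α b t := by
  induction t with
  | zero => rfl
  | succ t ih =>
    have e := ih fun s hs => h s (by omega)
    have hl := lastBatchEnd_le α b t
    have hc : ∀ i, cycleCount a i (t + 1) = cycleCount b i (t + 1) := fun i => by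
      rw [cycleCount, cycleCount, recordedTimes_congr i (t + 1) h]
    have hu : ∀ i, upperLimit α a i (lastBatchEnd α b t) = upperLimit α b i (lastBatchEnd α b t) :=
      fun i => by
        rw [upperLimit, upperLimit, cycleCount, cycleCount,
          recordedTimes_congr i _ fun s hs => h s (by omega)]
    simp only [lastBatchEnd, e, hc, hu, isCycleEnd_congr (t + 1) h]

/-- The action sequence satisfies the defining rule of the policy: at each time, an arm with the
largest sample is played. -/
lemma action_succ (sel : (Fin K → ℝ) → Fin K) (α σ : ℝ) (y z : ℕ → Fin K → ℝ) (t : ℕ) :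
    action sel α σ y z (t + 1) =
      sel (sample α σ y z (action sel α σ y z) (t + 1)) := by
  have h : ∀ s ≤ t, run sel α σ y z t s = action sel α σ y z s :=
    fun s hs => run_eq_action sel α σ y z t s hs
  have e := lastBatchEnd_congr α t h
  have hl := lastBatchEnd_le α (action sel α σ y z) t
  have hr : ∀ i, recordedTimes (run sel α σ y z t) i (lastBatchEnd α (action sel α σ y z) t) =
      recordedTimes (action sel α σ y z) i (lastBatchEnd α (action sel α σ y z) t) :=
    fun i => recordedTimes_congr i _ fun s hs => h s (hs.trans hl)
  conv_lhs => rw [action, run, Function.update_self]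
  congr 1
  funext i
  simp only [sample, recordedReward, cycleCount, Nat.add_sub_cancel, e, hr]

variable {Ω : Type*} [MeasurableSpace Ω]

/-- The rewards of a stochastic bandit: `Y t i` is the reward that arm `i` gives if it is pulled at
time `t`. Rewards take values in `[0, 1]`, those of a given arm are identically distributed, and
the reward vectors of different time steps are independent (nothing is asked of the joint law of
different arms at the same time step). -/
structure IsBandit (P : Measure Ω) (Y : ℕ → Fin K → Ω → ℝ) : Prop where
  measurable : ∀ t i, Measurable (Y t i)
  mem_Icc : ∀ t i, ∀ᵐ ω ∂P, Y t i ω ∈ Set.Icc (0 : ℝ) 1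
  identDistrib : ∀ i s t, IdentDistrib (Y s i) (Y t i) P P
  indep : iIndepFun (fun t ω i => Y t i ω) P

/-- The randomness of the policy: independent standard Gaussians `Z t i`, one for each time step
and each arm, that are jointly independent of the rewards. -/
structure IsSamplingNoise (P : Measure Ω) (Y Z : ℕ → Fin K → Ω → ℝ) : Prop where
  measurable : ∀ t i, Measurable (Z t i)
  gaussian : ∀ t i, HasLaw (Z t i) (gaussianReal 0 1) P
  indep : iIndepFun (fun (p : ℕ × Fin K) => Z p.1 p.2) P
  indep_rewards : IndepFun (fun ω t i => Y t i ω) (fun ω t i => Z t i ω) P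

/-- The mean reward `μ_i` of arm `i`. -/
noncomputable def mean (P : Measure Ω) (Y : ℕ → Fin K → Ω → ℝ) (i : Fin K) : ℝ :=
  ∫ ω, Y 1 i ω ∂P

/-- The gap `Δ_i` between the mean rewards of the optimal arm and of arm `i`. -/
noncomputable def gap (P : Measure Ω) (Y : ℕ → Fin K → Ω → ℝ) (best i : Fin K) : ℝ :=
  mean P Y best - mean P Y i

/-- The number `N_i(T)` of pulls of arm `i` up to time `T`, for an action sequence `a`. -/
def pulls (a : ℕ → Fin K) (i : Fin K) (T : ℕ) : ℕ :=
  ((Finset.Icc 1 T).filter fun t => a t = i).card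

/-- The expected number of pulls `E[N_i(T)]` of arm `i` under Batched Thompson sampling. -/
noncomputable def expectedPulls (P : Measure Ω) (Y Z : ℕ → Fin K → Ω → ℝ)
    (sel : (Fin K → ℝ) → Fin K) (α σ : ℝ) (i : Fin K) (T : ℕ) : ℝ :=
  ∫ ω, (pulls (action sel α σ (fun t j => Y t j ω) (fun t j => Z t j ω)) i T : ℝ) ∂P

/-- The expected cumulative regret `E[R(T)]`, the sum of `Δ_i E[N_i(T)]` over the suboptimal
arms. -/
noncomputable def expectedRegret (P : Measure Ω) (Y Z : ℕ → Fin K → Ω → ℝ)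
    (sel : (Fin K → ℝ) → Fin K) (α σ : ℝ) (best : Fin K) (T : ℕ) : ℝ :=
  ∑ i ∈ Finset.univ.erase best, gap P Y best i * expectedPulls P Y Z sel α σ i T

end BatchedTS

/-!
The expected number of pulls of a suboptimal arm `i` is of order `L ≈ α σ² log T / Δ²`. The two
regret bounds follow from this, the first by summation and the second by the Cauchy–Schwarz
inequality, because all pulls together number `T`.

Within a batch the distributions of the samples are fixed, and a pull of `i` is either recorded in
the cycle count `M_i` or repeats the previous action inside a cycle of `i`. Cycle counts control
only the recorded pulls, so the repetitions have to be charged to recorded events. Put the threshold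
`y` halfway between the mean of `i` and that of the best arm `b`. Given the past,

* a pull of `i` with a sample at most `y` has probability at most `G · P(b is played)`, where `1 / G`
  is a lower bound for the probability that the sample of `b` exceeds `y`: move only the sample of
  `b` above `y`. Unless a cycle of `b` is running, that play of `b` is recorded. A running cycle of
  `b` is ended by a pull of `i`, and this happens only once for each value of `M_b`;
* a pull of `i` with a sample above `y` has probability at most
  `F · (P(i is played with a sample at most y) + P(i is not played))`, where `1 / F` is a lower bound
  for the probability that the sample of `i` is at most `y`. If a cycle of `i` is running, a play of
  another arm ends it, which again happens only once for each value of `M_i`.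

This is `noiseLaw_play_le`. As soon as both arms have been recorded `L` times and their posterior
means are accurate, both kinds of pulls have probability at most `1 / T`. Before that, the charges
sum to a constant times `L` (`sum_playBound_le`), provided that `G²` and `F²` have bounded expectation
at every value of the cycle count. Both are at most a constant times `exp (9 D² / (5 k))`, where `D` is
the centered recorded reward at the last batch end point and `k` the current cycle count
(`cost_sq_le_peelSum`). The batch end point depends on the rewards, so the supremum over all times
with cycle count at most `k` is needed. It is controlled by a time-uniform Hoeffding inequality
(`jointLaw_exceeds_le`), whose tail `2 exp (-2 x² / k)` beats the exponent `9 / 5 < 2`. That exponent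
stays below `2` because the cycle counts grow at most by the factor `α` within a batch
(`cycleCount_le_mul_lastBatchEnd`) and `α ≤ 5 σ² / 4`.

Conditioning on the past is expressed by resampling: under the product law of the tables of rewards
and noise, replacing one row by an independent copy does not change expectations
(`lintegral_jointLaw_update_noise`, `lintegral_jointLaw_update_reward`), and the actions before that
row are not affected.
-/

namespace BatchedTS

open scoped ENNReal

/-! ### Resampling one coordinate of a product measure -/

lemma map_update_infinitePi {ι : Type*} [DecidableEq ι] {X : Type*} [MeasurableSpace X]
    (ν : ι → Measure X) [∀ t, IsProbabilityMeasure (ν t)] (t : ι) :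
    ((Measure.infinitePi ν).prod (ν t)).map (fun p => Function.update p.1 t p.2) =
      Measure.infinitePi ν := by
  have hm : Measurable fun p : (ι → X) × X => Function.update p.1 t p.2 :=
    measurable_update'
  refine Measure.eq_infinitePi _ fun s B hB => ?_
  rw [Measure.map_apply hm (.pi s.countable_toSet fun _ _ => hB _)]
  by_cases ht : t ∈ s
  · have : (fun p : (ι → X) × X => Function.update p.1 t p.2) ⁻¹' ((s : Set ι).pi B) =
        (((s.erase t : Finset ι) : Set ι).pi B) ×ˢ B t := by
      ext p
      simp only [Set.mem_preimage, Set.mem_pi, Finset.mem_coe, Set.mem_prod, Finset.mem_erase]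
      refine ⟨fun h => ⟨fun i hi => ?_, ?_⟩, fun h i hi => ?_⟩
      · simpa [hi.1] using h i hi.2
      · simpa using h t ht
      · by_cases e : i = t
        · subst e; simpa using h.2
        · simpa [e] using h.1 i ⟨e, hi⟩
    rw [this, Measure.prod_prod, Measure.infinitePi_pi _ fun i _ => hB i,
      Finset.prod_erase_mul _ _ ht]
  · have : (fun p : (ι → X) × X => Function.update p.1 t p.2) ⁻¹' ((s : Set ι).pi B) =
        ((s : Set ι).pi B) ×ˢ Set.univ := by
      ext p
      simp only [Set.mem_preimage, Set.mem_pi, Finset.mem_coe, Set.mem_prod, Set.mem_univ, and_true]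
      refine forall₂_congr fun i hi => ?_
      rw [Function.update_of_ne (ne_of_mem_of_not_mem hi ht)]
    rw [this, Measure.prod_prod, Measure.infinitePi_pi _ fun i _ => hB i, measure_univ, mul_one]

lemma lintegral_infinitePi_update {ι : Type*} [DecidableEq ι] {X : Type*} [MeasurableSpace X]
    (ν : ι → Measure X) [∀ t, IsProbabilityMeasure (ν t)] (t : ι) {F : (ι → X) → ℝ≥0∞}
    (hF : Measurable F) :
    ∫⁻ x, F x ∂(Measure.infinitePi ν) =
      ∫⁻ x, ∫⁻ w, F (Function.update x t w) ∂(ν t) ∂(Measure.infinitePi ν) := by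
  have hm : Measurable fun p : (ι → X) × X => Function.update p.1 t p.2 :=
    measurable_update'
  conv_lhs => rw [← map_update_infinitePi ν t, lintegral_map hF hm]
  exact lintegral_prod _ (hF.comp hm).aemeasurable

variable {K : ℕ}

/-- The law of one row of the noise table: independent standard Gaussians. -/
noncomputable def noiseLaw (K : ℕ) : Measure (Fin K → ℝ) := Measure.pi fun _ => gaussianReal 0 1

instance : IsProbabilityMeasure (noiseLaw K) := by unfold noiseLaw; infer_instance

/-- The joint law of reward table and noise table when the reward vector of time `t` has
law `ν t`. -/
noncomputable def jointLaw (ν : ℕ → Measure (Fin K → ℝ)) :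
    Measure ((ℕ → Fin K → ℝ) × (ℕ → Fin K → ℝ)) :=
  (Measure.infinitePi ν).prod (Measure.infinitePi fun _ => noiseLaw K)

instance (ν : ℕ → Measure (Fin K → ℝ)) [∀ t, IsProbabilityMeasure (ν t)] :
    IsProbabilityMeasure (jointLaw ν) := by unfold jointLaw; infer_instance

lemma lintegral_jointLaw_update_noise (ν : ℕ → Measure (Fin K → ℝ))
    [∀ t, IsProbabilityMeasure (ν t)] (t : ℕ)
    {F : (ℕ → Fin K → ℝ) × (ℕ → Fin K → ℝ) → ℝ≥0∞} (hF : Measurable F) :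
    ∫⁻ p, F p ∂(jointLaw ν) =
      ∫⁻ p, ∫⁻ w, F (p.1, Function.update p.2 t w) ∂(noiseLaw K) ∂(jointLaw ν) := by
  have hm : Measurable fun q : ((ℕ → Fin K → ℝ) × (ℕ → Fin K → ℝ)) × (Fin K → ℝ) =>
      F (q.1.1, Function.update q.1.2 t q.2) := by
    refine hF.comp (Measurable.prodMk (by fun_prop) ?_)
    exact measurable_update'.comp (f := fun q :
      ((ℕ → Fin K → ℝ) × (ℕ → Fin K → ℝ)) × (Fin K → ℝ) => (q.1.2, q.2)) (by fun_prop)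
  rw [jointLaw, lintegral_prod _ hF.aemeasurable,
    lintegral_prod _ (Measurable.lintegral_prod_right' hm).aemeasurable]
  refine lintegral_congr fun y => ?_
  exact lintegral_infinitePi_update (fun _ => noiseLaw K) t (hF.comp measurable_prodMk_left)

lemma lintegral_jointLaw_update_reward (ν : ℕ → Measure (Fin K → ℝ))
    [∀ t, IsProbabilityMeasure (ν t)] (t : ℕ)
    {F : (ℕ → Fin K → ℝ) × (ℕ → Fin K → ℝ) → ℝ≥0∞} (hF : Measurable F) :
    ∫⁻ p, F p ∂(jointLaw ν) =
      ∫⁻ p, ∫⁻ v, F (Function.update p.1 t v, p.2) ∂(ν t) ∂(jointLaw ν) := by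
  have hm : Measurable fun q : ((ℕ → Fin K → ℝ) × (ℕ → Fin K → ℝ)) × (Fin K → ℝ) =>
      F (Function.update q.1.1 t q.2, q.1.2) := by
    refine hF.comp (Measurable.prodMk ?_ (by fun_prop))
    exact measurable_update'.comp (f := fun q :
      ((ℕ → Fin K → ℝ) × (ℕ → Fin K → ℝ)) × (Fin K → ℝ) => (q.1.1, q.2)) (by fun_prop)
  rw [jointLaw, lintegral_prod_symm _ hF.aemeasurable,
    lintegral_prod_symm _ (Measurable.lintegral_prod_right' hm).aemeasurable]
  refine lintegral_congr fun z => ?_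
  exact lintegral_infinitePi_update ν t (hF.comp measurable_prodMk_right)

/-- The random tables of rewards and noise have a product law, to which resampling applies. -/
lemma map_tables_eq_jointLaw {Ω : Type*} [MeasurableSpace Ω] {P : Measure Ω}
    [IsProbabilityMeasure P] {Y Z : ℕ → Fin K → Ω → ℝ} (hY : IsBandit P Y)
    (hZ : IsSamplingNoise P Y Z) :
    P.map (fun ω => ((fun t i => Y t i ω), (fun t i => Z t i ω))) =
      jointLaw fun t => P.map fun ω i => Y t i ω := by
  have mY : Measurable fun ω => (fun t i => Y t i ω : ℕ → Fin K → ℝ) := by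
    have := hY.measurable; fun_prop
  have mZ : Measurable fun ω => (fun t i => Z t i ω : ℕ → Fin K → ℝ) := by
    have := hZ.measurable; fun_prop
  rw [(indepFun_iff_map_prod_eq_prod_map_map mY.aemeasurable mZ.aemeasurable).1 hZ.indep_rewards,
    jointLaw]
  congr 1
  · exact hY.indep.map_fun_eq_infinitePi_map fun t => by have := hY.measurable; fun_prop
  · have h := hZ.indep.map_fun_eq_infinitePi_map fun p : ℕ × Fin K => hZ.measurable p.1 p.2
    have hg : (fun p : ℕ × Fin K => P.map (Z p.1 p.2)) = fun _ => gaussianReal 0 1 :=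
      funext fun p => (hZ.gaussian p.1 p.2).map_eq
    rw [hg] at h
    have h2 := Measure.infinitePi_map_curry (X := ℝ) fun (_ : ℕ) (_ : Fin K) => gaussianReal 0 1
    rw [← h, Measure.map_map (by fun_prop)
      (measurable_pi_iff.2 fun p : ℕ × Fin K => hZ.measurable p.1 p.2)] at h2
    simp only [Measure.infinitePi_eq_pi] at h2
    exact h2

/-! ### Cycles and batches of an action sequence -/

/-- At time `t` a cycle that began earlier with arm `i` is still running, before the action of
time `t` is known: every action of the cycle so far is `i`. -/
def InRun (a : ℕ → Fin K) (i : Fin K) (t : ℕ) : Prop := cycleStart a t < t ∧ a (t - 1) = i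

/-- Arm `i` is played at time `t`, and `t` is the beginning or the end of a cycle. -/
def Recorded (a : ℕ → Fin K) (i : Fin K) (t : ℕ) : Prop :=
  a t = i ∧ (IsCycleBegin a t ∨ IsCycleEnd a t)

/-- At time `t` a cycle that began with arm `i` ends. -/
def RunEnd (a : ℕ → Fin K) (i : Fin K) (t : ℕ) : Prop := InRun a i t ∧ a t ≠ i

instance (a : ℕ → Fin K) (i : Fin K) (t : ℕ) : Decidable (InRun a i t) := by
  unfold InRun; infer_instance

instance (a : ℕ → Fin K) (i : Fin K) (t : ℕ) : Decidable (Recorded a i t) := by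
  unfold Recorded; infer_instance

instance (a : ℕ → Fin K) (i : Fin K) (t : ℕ) : Decidable (RunEnd a i t) := by
  unfold RunEnd; infer_instance

section Combinatorics

variable (a : ℕ → Fin K) (j : Fin K)

lemma cycleStart_succ (t : ℕ) :
    cycleStart a (t + 1) = if IsCycleEnd a t then t + 1 else cycleStart a t := rfl

/-- The start of the cycle containing `t` is a cycle beginning, and the cycle is constant from its
start up to time `t - 1`. -/
lemma cycleStart_spec {t : ℕ} (ht : 1 ≤ t) :
    1 ≤ cycleStart a t ∧ cycleStart a t ≤ t ∧ cycleStart a (cycleStart a t) = cycleStart a t ∧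
      ∀ s, cycleStart a t ≤ s → s < t → a s = a (cycleStart a t) := by
  induction t, ht using Nat.le_induction with
  | base =>
    have h : cycleStart a 1 = 1 := by simp [cycleStart]
    refine ⟨h.ge, h.le, by rw [h, h], fun s h1 h2 => ?_⟩
    omega
  | succ t ht ih =>
    rw [cycleStart_succ]
    split_ifs with h
    · refine ⟨by omega, le_rfl, by rw [cycleStart_succ, if_pos h], fun s h1 h2 => ?_⟩
      omega
    · refine ⟨ih.1, by omega, ih.2.2.1, fun s h1 h2 => ?_⟩
      rcases Nat.lt_or_ge s t with hs | hs
      · exact ih.2.2.2 s h1 hs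
      · obtain rfl : s = t := by omega
        rcases Nat.lt_or_ge (cycleStart a s) s with hc | hc
        · have : a s = a (s - 1) := by
            by_contra hne
            exact h ⟨hc, hne⟩
          rw [this]
          exact ih.2.2.2 _ (by omega) (by omega)
        · rw [show cycleStart a s = s by omega]

lemma cycleStart_mono : Monotone (cycleStart a) := by
  refine monotone_nat_of_le_succ fun t => ?_
  rw [cycleStart_succ]
  split_ifs with h
  · exact h.1.le.trans (by omega)
  · exact le_rfl

lemma recorded_of_not_inRun {t : ℕ} (ht : 1 ≤ t) (h : a t = j) (hr : ¬ InRun a j t) :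
    Recorded a j t := by
  refine ⟨h, ?_⟩
  rcases (cycleStart_spec a ht).2.1.eq_or_lt with e | e
  · exact Or.inl e
  · refine Or.inr ⟨e, fun hc => hr ⟨e, ?_⟩⟩
    rw [← hc, h]

lemma cycleCount_succ (t : ℕ) :
    cycleCount a j (t + 1) = cycleCount a j t + if Recorded a j (t + 1) then 1 else 0 := by
  rw [cycleCount, cycleCount, recordedTimes, recordedTimes,
    ← Finset.insert_Icc_right_eq_Icc_add_one (by omega), Finset.filter_insert]
  by_cases h : Recorded a j (t + 1)
  · rw [if_pos h, if_pos (show _ ∧ _ from h), Finset.card_insert_of_notMem (by simp)]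
  · rw [if_neg h, if_neg (show ¬ (_ ∧ _) from h), add_zero]

lemma recordedReward_succ (y : ℕ → Fin K → ℝ) (t : ℕ) :
    recordedReward y a j (t + 1) =
      recordedReward y a j t + if Recorded a j (t + 1) then y (t + 1) j else 0 := by
  rw [recordedReward, recordedReward, recordedTimes, recordedTimes,
    ← Finset.insert_Icc_right_eq_Icc_add_one (by omega), Finset.filter_insert]
  by_cases h : Recorded a j (t + 1)
  · rw [if_pos h, if_pos (show _ ∧ _ from h), Finset.sum_insert (by simp), add_comm]
  · rw [if_neg h, if_neg (show ¬ (_ ∧ _) from h), add_zero]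

@[simp] lemma cycleCount_zero : cycleCount a j 0 = 0 := by simp [cycleCount, recordedTimes]

@[simp] lemma recordedReward_zero (y : ℕ → Fin K → ℝ) : recordedReward y a j 0 = 0 := by
  simp [recordedReward, recordedTimes]

lemma cycleCount_mono : Monotone (cycleCount a j) :=
  monotone_nat_of_le_succ fun t => by rw [cycleCount_succ]; omega

lemma cycleCount_le (t : ℕ) : cycleCount a j t ≤ t := by
  induction t with
  | zero => simp
  | succ t ih => rw [cycleCount_succ]; split_ifs <;> omega

variable {a j}

lemma cycleCount_lt_of_recorded {t s : ℕ} (ht : 1 ≤ t) (hts : t ≤ s) (h : Recorded a j t) :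
    cycleCount a j (t - 1) < cycleCount a j s := by
  have := cycleCount_succ a j (t - 1)
  rw [Nat.sub_add_cancel ht, if_pos h] at this
  have := cycleCount_mono a j hts
  omega

/-- Between the end of a cycle of arm `j` and the time at which a later cycle of `j` is running, the
beginning of the later cycle has been recorded. -/
lemma cycleCount_lt_of_runEnd {t s : ℕ} (hts : t < s) (h : RunEnd a j t)
    (h' : InRun a j s) : cycleCount a j (t - 1) < cycleCount a j (s - 1) := by
  have hs := cycleStart_spec a (t := s) (by omega)
  have hend : IsCycleEnd a t := ⟨h.1.1, by rw [h.1.2]; exact h.2⟩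
  have h1 : t + 1 ≤ cycleStart a s := by
    have := cycleStart_mono a (show t + 1 ≤ s from hts)
    rwa [cycleStart_succ, if_pos hend] at this
  have hlt := h'.1
  have hrec : Recorded a j (cycleStart a s) := by
    refine ⟨?_, Or.inl hs.2.2.1⟩
    rw [← hs.2.2.2 (s - 1) (by omega) (by omega), h'.2]
  have h2 := cycleCount_lt_of_recorded hs.1 (show cycleStart a s ≤ s - 1 by omega) hrec
  have h3 := cycleCount_mono a j (show t - 1 ≤ cycleStart a s - 1 by omega)
  omega

/-- Before the end of a batch no cycle count exceeds its upper limit. A cycle adds at most one to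
every count, because it starts and ends with different arms, and counts below their limits at the
start of a cycle cannot jump over them. -/
lemma cycleCount_le_upperLimit {α : ℝ} (hα : 1 < α) (t : ℕ) :
    ∀ j, cycleCount a j (cycleStart a (t + 1) - 1) < upperLimit α a j (lastBatchEnd α a t) ∧
      cycleCount a j t ≤ cycleCount a j (cycleStart a (t + 1) - 1) +
        if cycleStart a (t + 1) ≤ t ∧ a (cycleStart a (t + 1)) = j then 1 else 0 := by
  induction t with
  | zero => intro j; simp [cycleStart, upperLimit]
  | succ t ih =>
    intro j
    have hs := cycleStart_spec a (t := t + 1) (by omega)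
    obtain ⟨ih1, ih2⟩ := ih j
    have hc := cycleCount_succ a j t
    by_cases hend : IsCycleEnd a (t + 1)
    · have e : cycleStart a (t + 1 + 1) = t + 1 + 1 := by rw [cycleStart_succ, if_pos hend]
      have hle : cycleCount a j (t + 1) ≤ upperLimit α a j (lastBatchEnd α a t) := by
        have hne : a (t + 1) ≠ a (cycleStart a (t + 1)) := by
          rw [← hs.2.2.2 t (by have := hend.1; omega) (by omega)]
          exact hend.2
        have h1 : (if Recorded a j (t + 1) then 1 else 0) ≤ if a (t + 1) = j then 1 else 0 := by
          split_ifs with h2 h3 <;> first | exact absurd h2.1 h3 | omega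
        have h4 : (if cycleStart a (t + 1) ≤ t ∧ a (cycleStart a (t + 1)) = j then 1 else 0) +
            (if a (t + 1) = j then 1 else 0) ≤ 1 := by
          split_ifs with h2 h3 <;>
            first | exact absurd (h3.trans h2.2.symm) hne | omega
        omega
      rw [e, Nat.add_sub_cancel]
      refine ⟨?_, Nat.le_add_right _ _⟩
      rw [lastBatchEnd]
      split_ifs with hb
      · rw [upperLimit, lt_max_iff]
        rcases Nat.eq_zero_or_pos (cycleCount a j (t + 1)) with h0 | h0
        · left; omega
        · right
          rw [Nat.lt_ceil]
          have : (0 : ℝ) < cycleCount a j (t + 1) := by exact_mod_cast h0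
          nlinarith
      · refine lt_of_le_of_ne hle fun h => hb ⟨hend, j, h⟩
    · have e : cycleStart a (t + 1 + 1) = cycleStart a (t + 1) := by
        rw [cycleStart_succ, if_neg hend]
      rw [e, lastBatchEnd, if_neg fun h => hend h.1]
      refine ⟨ih1, ?_⟩
      rcases hs.2.1.eq_or_lt with h | h
      · rw [h, Nat.add_sub_cancel, hc]
        gcongr
        split_ifs with h1 h2 <;> first | exact absurd ⟨le_rfl, h1.1⟩ h2 | omega
      · have hr : ¬ Recorded a j (t + 1) := fun hr => by
          rcases hr.2 with hb | hb
          · exact absurd hb h.ne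
          · exact hend hb
        rw [if_neg hr] at hc
        rw [hc, add_zero]
        refine ih2.trans ?_
        gcongr
        split_ifs with h1 h2 <;> first | exact absurd ⟨by omega, h1.2⟩ h2 | omega

/-- During a batch the cycle counts grow at most by the factor `α`, up to rounding. -/
lemma cycleCount_le_mul_lastBatchEnd {α : ℝ} (hα : 1 < α) (t : ℕ) (j : Fin K) :
    (cycleCount a j t : ℝ) ≤ α * cycleCount a j (lastBatchEnd α a t) + 1 := by
  obtain ⟨h1, h2⟩ := cycleCount_le_upperLimit (a := a) hα t j
  have h3 : cycleCount a j t ≤ upperLimit α a j (lastBatchEnd α a t) := by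
    split_ifs at h2 <;> omega
  have h4 : (0 : ℝ) ≤ α * cycleCount a j (lastBatchEnd α a t) := by positivity
  refine (Nat.cast_le.2 h3).trans ?_
  rw [upperLimit, Nat.cast_max, max_le_iff]
  exact ⟨by simpa using h4, (Nat.ceil_lt_add_one h4).le⟩

end Combinatorics

/-! ### Which data the actions depend on, and measurability -/

lemma sample_congr {α σ : ℝ} {y y' z z' : ℕ → Fin K → ℝ} {a a' : ℕ → Fin K} {t : ℕ}
    (hy : ∀ s < t, y s = y' s) (hz : z t = z' t) (ha : ∀ s < t, a s = a' s) (h0 : 1 ≤ t) :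
    sample α σ y z a t = sample α σ y' z' a' t := by
  obtain ⟨t, rfl⟩ := Nat.exists_eq_add_of_le' h0
  have ha' : ∀ s ≤ t, a s = a' s := fun s hs => ha s (by omega)
  have hl := lastBatchEnd_le α a' t
  have e := lastBatchEnd_congr α t ha'
  funext i
  have hr := recordedTimes_congr i (lastBatchEnd α a' t) fun s hs => ha' s (hs.trans hl)
  have hS : recordedReward y a i (lastBatchEnd α a' t) =
      recordedReward y' a' i (lastBatchEnd α a' t) := by
    rw [recordedReward, recordedReward, hr]
    refine Finset.sum_congr rfl fun s hs => ?_
    have := (Finset.mem_Icc.1 (Finset.mem_filter.1 hs).1).2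
    rw [hy s (by omega)]
  simp only [sample, Nat.add_sub_cancel, e, hS, cycleCount, hr, hz]

lemma action_congr (sel : (Fin K → ℝ) → Fin K) (α σ : ℝ) {y y' z z' : ℕ → Fin K → ℝ} (t : ℕ)
    (hy : ∀ s < t, y s = y' s) (hz : ∀ s ≤ t, z s = z' s) :
    action sel α σ y z t = action sel α σ y' z' t := by
  induction t using Nat.strong_induction_on with
  | _ t ih =>
    rcases t with _ | t
    · rfl
    · rw [action_succ, action_succ]
      congr 1
      exact sample_congr hy (hz _ le_rfl)
        (fun s hs => ih s hs (fun u hu => hy u (by omega)) fun u hu => hz u (by omega)) (by omega)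

lemma action_update_noise (sel : (Fin K → ℝ) → Fin K) (α σ : ℝ) (y z : ℕ → Fin K → ℝ) {s t : ℕ}
    (h : s < t) (w : Fin K → ℝ) :
    action sel α σ y (Function.update z t w) s = action sel α σ y z s :=
  action_congr sel α σ s (fun _ _ => rfl) fun u hu => Function.update_of_ne (by omega) _ _

lemma action_update_reward (sel : (Fin K → ℝ) → Fin K) (α σ : ℝ) (y z : ℕ → Fin K → ℝ) {s t : ℕ}
    (h : s ≤ t) (v : Fin K → ℝ) :
    action sel α σ (Function.update y t v) z s = action sel α σ y z s :=
  action_congr sel α σ s (fun u hu => Function.update_of_ne (by omega) _ _) fun _ _ => rfl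

lemma cycleCount_congr {a b : ℕ → Fin K} (i : Fin K) (t : ℕ) (h : ∀ s ≤ t, a s = b s) :
    cycleCount a i t = cycleCount b i t := by
  rw [cycleCount, cycleCount, recordedTimes_congr i t h]

lemma recordedReward_congr {y y' : ℕ → Fin K → ℝ} {a b : ℕ → Fin K} (i : Fin K) (t : ℕ)
    (hy : ∀ s ≤ t, y s = y' s) (h : ∀ s ≤ t, a s = b s) :
    recordedReward y a i t = recordedReward y' b i t := by
  rw [recordedReward, recordedReward, recordedTimes_congr i t h]
  refine Finset.sum_congr rfl fun s hs => ?_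
  rw [hy s (Finset.mem_Icc.1 (Finset.mem_filter.1 hs).1).2]

lemma inRun_congr {a b : ℕ → Fin K} (i : Fin K) {t : ℕ} (ht : 1 ≤ t) (h : ∀ s < t, a s = b s) :
    InRun a i t ↔ InRun b i t := by
  rw [InRun, InRun, cycleStart_congr t h, h (t - 1) (by omega)]

lemma recorded_congr {a b : ℕ → Fin K} (i : Fin K) (t : ℕ) (h : ∀ s ≤ t, a s = b s) :
    Recorded a i t ↔ Recorded b i t := by
  rw [Recorded, Recorded, isCycleEnd_congr t h, IsCycleBegin, IsCycleBegin,
    cycleStart_congr t fun s hs => h s hs.le, h t le_rfl]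

/-- A function of the action sequence that only looks at finitely many actions is measurable. -/
lemma measurable_of_dependsOn_le {β : Type*} [MeasurableSpace β] {f : (ℕ → Fin K) → β} (t : ℕ)
    (h : ∀ a b : ℕ → Fin K, (∀ s ≤ t, a s = b s) → f a = f b) : Measurable f := by
  let g : (Fin (t + 1) → Fin K) → β := fun b => f fun s => b (Fin.ofNat (t + 1) s)
  have hg : Measurable g := measurable_of_finite g
  have e : f = g ∘ fun a (s : Fin (t + 1)) => a s := by
    funext a
    refine h _ _ fun s hs => ?_
    simp [Nat.mod_eq_of_lt (Nat.lt_succ_of_le hs)]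
  rw [e]
  exact hg.comp (by fun_prop)

lemma measurable_recordedReward (i : Fin K) (t : ℕ) {τ : (ℕ → Fin K) → ℕ}
    (hle : ∀ a, τ a ≤ t) (hτ : ∀ a b : ℕ → Fin K, (∀ s ≤ t, a s = b s) → τ a = τ b) :
    Measurable fun q : (ℕ → Fin K → ℝ) × (ℕ → Fin K) => recordedReward q.1 q.2 i (τ q.2) := by
  have e : (fun q : (ℕ → Fin K → ℝ) × (ℕ → Fin K) => recordedReward q.1 q.2 i (τ q.2)) =
      fun q => ∑ s ∈ Finset.Icc 1 t,
        (if s ∈ recordedTimes q.2 i (τ q.2) then (1 : ℝ) else 0) * q.1 s i := by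
    funext q
    rw [recordedReward]
    simp only [ite_mul, one_mul, zero_mul]
    rw [← Finset.sum_filter]
    congr 1
    ext s
    simp only [Finset.mem_filter, Finset.mem_Icc, recordedTimes]
    have := hle q.2
    constructor
    · rintro ⟨h1, h2⟩; exact ⟨⟨h1.1, by omega⟩, h1, h2⟩
    · exact fun h => h.2
  rw [e]
  refine Finset.measurable_sum _ fun s _ => Measurable.mul ?_ (by fun_prop)
  have hm : Measurable fun a : ℕ → Fin K =>
      (if s ∈ recordedTimes a i (τ a) then (1 : ℝ) else 0) :=
    measurable_of_dependsOn_le t fun a b h => by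
      rw [hτ a b h, recordedTimes_congr i _ fun s hs => h s (hs.trans (hle b))]
  exact hm.comp measurable_snd

lemma measurable_cycleCount (i : Fin K) (t : ℕ) : Measurable fun a => cycleCount a i t :=
  measurable_of_dependsOn_le t fun _ _ h => cycleCount_congr i t h

lemma measurable_cycleCount_lastBatchEnd (α : ℝ) (i : Fin K) (t : ℕ) :
    Measurable fun a => cycleCount a i (lastBatchEnd α a t) :=
  measurable_of_dependsOn_le t fun a b h => by
    rw [lastBatchEnd_congr α t h,
      cycleCount_congr i _ fun s hs => h s (hs.trans (lastBatchEnd_le α b t))]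

lemma measurable_recordedReward_lastBatchEnd (α : ℝ) (i : Fin K) (t : ℕ) :
    Measurable fun q : (ℕ → Fin K → ℝ) × (ℕ → Fin K) =>
      recordedReward q.1 q.2 i (lastBatchEnd α q.2 t) :=
  measurable_recordedReward i t (fun a => lastBatchEnd_le α a t)
    fun _ _ h => lastBatchEnd_congr α t h

lemma measurable_run {sel : (Fin K → ℝ) → Fin K} (hsel : IsArgmax sel) (α σ : ℝ) (t : ℕ) :
    Measurable fun p : (ℕ → Fin K → ℝ) × (ℕ → Fin K → ℝ) => run sel α σ p.1 p.2 t := by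
  induction t with
  | zero => exact measurable_const
  | succ t ih =>
    have hq : Measurable fun p : (ℕ → Fin K → ℝ) × (ℕ → Fin K → ℝ) =>
        (p.1, run sel α σ p.1 p.2 t) := measurable_fst.prodMk ih
    have hs : Measurable fun p : (ℕ → Fin K → ℝ) × (ℕ → Fin K → ℝ) =>
        sample α σ p.1 p.2 (run sel α σ p.1 p.2 t) (t + 1) := by
      refine measurable_pi_iff.2 fun i => ?_
      have h1 := (measurable_recordedReward_lastBatchEnd α i t).comp hq
      have h2 := (measurable_cycleCount_lastBatchEnd α i t).comp ih
      have h3 : Measurable fun p : (ℕ → Fin K → ℝ) × (ℕ → Fin K → ℝ) => p.2 (t + 1) i := by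
        fun_prop
      have h4 : Measurable fun p : (ℕ → Fin K → ℝ) × (ℕ → Fin K → ℝ) =>
          (1 + (cycleCount (run sel α σ p.1 p.2 t) i
            (lastBatchEnd α (run sel α σ p.1 p.2 t) t) : ℝ)) :=
        (measurable_of_countable fun n : ℕ => (1 + n : ℝ)).comp h2
      exact (h1.div h4).add ((measurable_const.div h4.sqrt).mul h3)
    exact measurable_update'.comp (f := fun p : (ℕ → Fin K → ℝ) × (ℕ → Fin K → ℝ) =>
      (run sel α σ p.1 p.2 t, sel (sample α σ p.1 p.2 (run sel α σ p.1 p.2 t) (t + 1))))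
      (ih.prodMk (hsel.measurable.comp hs))

lemma measurable_action {sel : (Fin K → ℝ) → Fin K} (hsel : IsArgmax sel) (α σ : ℝ) :
    Measurable fun p : (ℕ → Fin K → ℝ) × (ℕ → Fin K → ℝ) => action sel α σ p.1 p.2 :=
  measurable_pi_iff.2 fun t => (measurable_pi_apply t).comp (measurable_run hsel α σ t)

/-! ### Gaussian tails -/

/-- An upper bound for the reciprocal of the probability that a standard Gaussian exceeds `u`. -/
noncomputable def invTail (u : ℝ) : ℝ≥0∞ := ENNReal.ofReal (3 * Real.exp ((u + 1) ^ 2 / 2))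

lemma one_le_invTail (u : ℝ) : 1 ≤ invTail u := by
  rw [invTail, ENNReal.one_le_ofReal]
  have := Real.add_one_le_exp ((u + 1) ^ 2 / 2)
  nlinarith [sq_nonneg (u + 1)]

lemma measurable_invTail : Measurable invTail := by unfold invTail; fun_prop

lemma one_le_invTail_mul_Ioi {u : ℝ} (hu : 0 ≤ u) :
    1 ≤ invTail u * gaussianReal 0 1 (Set.Ioi u) := by
  have h1 : ENNReal.ofReal (gaussianPDFReal 0 1 (u + 1)) ≤ gaussianReal 0 1 (Set.Ioi u) := by
    calc ENNReal.ofReal (gaussianPDFReal 0 1 (u + 1))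
        = ∫⁻ _ in Set.Ioc u (u + 1), ENNReal.ofReal (gaussianPDFReal 0 1 (u + 1)) := by simp
      _ ≤ ∫⁻ x in Set.Ioc u (u + 1), gaussianPDF 0 1 x := by
          refine setLIntegral_mono (measurable_gaussianPDF 0 1) fun x hx => ?_
          refine ENNReal.ofReal_le_ofReal ?_
          simp only [gaussianPDFReal]
          gcongr ?_ * Real.exp ?_
          simp only [NNReal.coe_one, sub_zero, mul_one]
          have := hx.1; have := hx.2
          nlinarith
      _ = gaussianReal 0 1 (Set.Ioc u (u + 1)) := (gaussianReal_apply 0 one_ne_zero _).symm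
      _ ≤ _ := measure_mono Set.Ioc_subset_Ioi_self
  refine le_trans ?_ (mul_le_mul_right h1 _)
  rw [invTail, ← ENNReal.ofReal_mul (by positivity), ENNReal.one_le_ofReal]
  simp only [gaussianPDFReal, NNReal.coe_one, sub_zero, mul_one]
  have h3 : √(2 * Real.pi) ≤ 3 := by
    rw [Real.sqrt_le_left (by norm_num)]
    have := Real.pi_lt_d2
    linarith
  have h4 : 0 < √(2 * Real.pi) := by positivity
  have h5 : Real.exp ((u + 1) ^ 2 / 2) * Real.exp (-(u + 1) ^ 2 / 2) = 1 := by
    rw [← Real.exp_add, ← Real.exp_zero]; congr 1; ring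
  calc (1 : ℝ) ≤ 3 * (√(2 * Real.pi))⁻¹ := by rw [← div_eq_mul_inv, le_div_iff₀ h4]; linarith
    _ = 3 * (√(2 * Real.pi))⁻¹ * (Real.exp ((u + 1) ^ 2 / 2) * Real.exp (-(u + 1) ^ 2 / 2)) := by
        rw [h5, mul_one]
    _ = _ := by ring

lemma gaussianReal_preimage_neg {s : Set ℝ} (hs : MeasurableSet s) :
    gaussianReal 0 1 ((fun x => -x) ⁻¹' s) = gaussianReal 0 1 s := by
  rw [← Measure.map_apply measurable_neg hs, gaussianReal_map_neg, neg_zero]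

/-- A Gaussian sample exceeds a threshold below `μ` with probability at least the reciprocal of
`invTail`, evaluated at the distance of its mean from `μ` in standard deviations. -/
lemma one_le_invTail_mul_gt {m s μ y : ℝ} (hs : 0 < s) (hy : y ≤ μ) :
    1 ≤ invTail (|m - μ| / s) * gaussianReal 0 1 {x | y < m + s * x} := by
  refine (one_le_invTail_mul_Ioi (by positivity)).trans (mul_le_mul_right (measure_mono ?_) _)
  intro x hx
  rw [Set.mem_Ioi, div_lt_iff₀ hs] at hx
  have := neg_abs_le (m - μ)
  simp only [Set.mem_ofPred_eq]
  nlinarith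

lemma one_le_invTail_mul_le {m s μ y : ℝ} (hs : 0 < s) (hy : μ ≤ y) :
    1 ≤ invTail (|m - μ| / s) * gaussianReal 0 1 {x | m + s * x ≤ y} := by
  refine (one_le_invTail_mul_Ioi (by positivity)).trans (mul_le_mul_right ?_ _)
  rw [← gaussianReal_preimage_neg measurableSet_Ioi]
  refine measure_mono fun x hx => ?_
  rw [Set.mem_preimage, Set.mem_Ioi, div_lt_iff₀ hs] at hx
  have := le_abs_self (m - μ)
  simp only [Set.mem_ofPred_eq]
  nlinarith

lemma gaussianReal_Ici_le {u : ℝ} (hu : 0 ≤ u) :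
    gaussianReal 0 1 (Set.Ici u) ≤ ENNReal.ofReal (Real.exp (-(u ^ 2 / 2))) := by
  have h : HasSubgaussianMGF id 1 (gaussianReal 0 1) :=
    ⟨fun t => integrable_exp_mul_gaussianReal t, fun t => by
      rw [mgf_id_gaussianReal]; simp⟩
  have := h.measure_ge_le hu
  rw [← ofReal_measureReal]
  refine ENNReal.ofReal_le_ofReal (this.trans_eq ?_)
  congr 1
  simp only [NNReal.coe_one]; ring

lemma gaussianReal_gt_le {m s y c : ℝ} (hs : 0 < s) (hc : 0 ≤ c) (h : m + c ≤ y) :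
    gaussianReal 0 1 {x | y < m + s * x} ≤ ENNReal.ofReal (Real.exp (-((c / s) ^ 2 / 2))) := by
  refine (measure_mono fun x hx => ?_).trans (gaussianReal_Ici_le (by positivity))
  simp only [Set.mem_ofPred_eq] at hx
  rw [Set.mem_Ici, div_le_iff₀ hs]
  nlinarith

lemma gaussianReal_le_le {m s y c : ℝ} (hs : 0 < s) (hc : 0 ≤ c) (h : y + c ≤ m) :
    gaussianReal 0 1 {x | m + s * x ≤ y} ≤ ENNReal.ofReal (Real.exp (-((c / s) ^ 2 / 2))) := by
  refine le_trans ?_ (gaussianReal_Ici_le (u := c / s) (by positivity))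
  rw [← gaussianReal_preimage_neg measurableSet_Ici]
  refine measure_mono fun x hx => ?_
  simp only [Set.mem_ofPred_eq] at hx
  rw [Set.mem_preimage, Set.mem_Ici, div_le_iff₀ hs]
  nlinarith

/-! ### One step of Thompson sampling with a fixed posterior -/

section OneStep

variable {sel : (Fin K → ℝ) → Fin K} (hsel : IsArgmax sel) (m s : Fin K → ℝ)

lemma noiseLaw_eval (j : Fin K) {B : Set ℝ} (hB : MeasurableSet B) :
    noiseLaw K {w | w j ∈ B} = gaussianReal 0 1 B :=
  (measurePreserving_eval (fun _ : Fin K => gaussianReal 0 1) j).measure_preimage hB.nullMeasurableSet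

include hsel in
/-- If `i` is played with a sample below `y`, then all samples are below `y`, and resampling `b`
alone above `y` makes `b` the played arm. -/
lemma noiseLaw_play_le_le {i b : Fin K} {y : ℝ} {G : ℝ≥0∞}
    (hG : 1 ≤ G * gaussianReal 0 1 {x | y < m b + s b * x}) :
    noiseLaw K {w | sel (fun j => m j + s j * w j) = i ∧ m i + s i * w i ≤ y} ≤
      G * noiseLaw K {w | sel (fun j => m j + s j * w j) = b} := by
  let B : Fin K → Set ℝ := fun j => {x | m j + s j * x ≤ y}
  let B₁ : Fin K → Set ℝ := fun j => if j = b then Set.univ else B j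
  let B₂ : Fin K → Set ℝ := fun j => if j = b then {x | y < m b + s b * x} else B j
  have h1 : noiseLaw K {w | sel (fun j => m j + s j * w j) = i ∧ m i + s i * w i ≤ y} ≤
      noiseLaw K (Set.univ.pi B₁) := by
    refine measure_mono fun w hw j _ => ?_
    simp only [B₁]
    split_ifs with hj
    · trivial
    · have := hsel.le (fun j => m j + s j * w j) j
      rw [hw.1] at this
      exact this.trans hw.2
  have h2 : noiseLaw K (Set.univ.pi B₂) ≤
      noiseLaw K {w | sel (fun j => m j + s j * w j) = b} := by
    refine measure_mono fun w hw => ?_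
    by_contra hne
    have hb := hw b trivial
    have hs := hw (sel fun j => m j + s j * w j) trivial
    simp only [B₂, if_true, if_neg (show ¬ sel (fun j => m j + s j * w j) = b from hne)] at hb hs
    have := hsel.le (fun j => m j + s j * w j) b
    simp only [B, Set.mem_ofPred_eq] at hs hb this
    linarith
  have e1 : noiseLaw K (Set.univ.pi B₁) = ∏ j ∈ Finset.univ.erase b, gaussianReal 0 1 (B j) := by
    rw [noiseLaw, Measure.pi_pi, ← Finset.mul_prod_erase _ _ (Finset.mem_univ b)]
    simp only [B₁, if_true, measure_univ, one_mul]
    exact Finset.prod_congr rfl fun j hj => by rw [if_neg (Finset.ne_of_mem_erase hj)]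
  have e2 : noiseLaw K (Set.univ.pi B₂) = gaussianReal 0 1 {x | y < m b + s b * x} *
      ∏ j ∈ Finset.univ.erase b, gaussianReal 0 1 (B j) := by
    rw [noiseLaw, Measure.pi_pi, ← Finset.mul_prod_erase _ _ (Finset.mem_univ b)]
    simp only [B₂, if_true]
    congr 1
    exact Finset.prod_congr rfl fun j hj => by rw [if_neg (Finset.ne_of_mem_erase hj)]
  calc _ ≤ _ := h1
    _ = 1 * noiseLaw K (Set.univ.pi B₁) := (one_mul _).symm
    _ ≤ (G * gaussianReal 0 1 {x | y < m b + s b * x}) * noiseLaw K (Set.univ.pi B₁) := by gcongr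
    _ = G * noiseLaw K (Set.univ.pi B₂) := by rw [e1, e2, mul_assoc]
    _ ≤ _ := by gcongr

/-- A high sample of the played arm `i` is charged to the low samples of `i`, at which either `i`
is still played or another arm is. -/
lemma noiseLaw_play_gt_le {i : Fin K} {y : ℝ} {F : ℝ≥0∞}
    (hF : 1 ≤ F * gaussianReal 0 1 {x | m i + s i * x ≤ y}) :
    noiseLaw K {w | sel (fun j => m j + s j * w j) = i ∧ y < m i + s i * w i} ≤
      F * (noiseLaw K {w | sel (fun j => m j + s j * w j) = i ∧ m i + s i * w i ≤ y} +
        noiseLaw K {w | sel (fun j => m j + s j * w j) ≠ i}) := by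
  refine (prob_le_one.trans hF).trans (mul_le_mul_right ?_ _)
  rw [← noiseLaw_eval i (measurableSet_le (by fun_prop) measurable_const)]
  refine le_trans (measure_mono fun w hw => ?_) (measure_union_le _ _)
  by_cases h : sel (fun j => m j + s j * w j) = i
  · exact Or.inl ⟨h, hw⟩
  · exact Or.inr h

include hsel in
lemma noiseLaw_play_le_le_eval {i b : Fin K} {y : ℝ} :
    noiseLaw K {w | sel (fun j => m j + s j * w j) = i ∧ m i + s i * w i ≤ y} ≤
      gaussianReal 0 1 {x | m b + s b * x ≤ y} := by
  rw [← noiseLaw_eval b (measurableSet_le (by fun_prop) measurable_const)]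
  refine measure_mono fun w hw => ?_
  have := hsel.le (fun j => m j + s j * w j) b
  rw [hw.1] at this
  exact this.trans hw.2

lemma noiseLaw_play_gt_le_eval {i : Fin K} {y : ℝ} :
    noiseLaw K {w | sel (fun j => m j + s j * w j) = i ∧ y < m i + s i * w i} ≤
      gaussianReal 0 1 {x | y < m i + s i * x} := by
  rw [← noiseLaw_eval i (measurableSet_lt measurable_const (by fun_prop))]
  exact measure_mono fun w hw => hw.2

end OneStep

/-! ### A maximal inequality for the recorded rewards -/

/-- The recorded reward of arm `j` up to time `t`, centered at `μ` per recorded pull, as a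
function of the tables of rewards and noise. -/
noncomputable def centeredReward (sel : (Fin K → ℝ) → Fin K) (α σ : ℝ) (j : Fin K) (μ : ℝ) (t : ℕ)
    (p : (ℕ → Fin K → ℝ) × (ℕ → Fin K → ℝ)) : ℝ :=
  recordedReward p.1 (action sel α σ p.1 p.2) j t -
    cycleCount (action sel α σ p.1 p.2) j t * μ

/-- At some time up to `T` at which arm `j` has been recorded at most `k` times, its centered
reward, multiplied by the sign `ε`, is at least `x`. -/
def Exceeds (sel : (Fin K → ℝ) → Fin K) (α σ : ℝ) (j : Fin K) (μ ε : ℝ) (k : ℕ) (x : ℝ) (T : ℕ)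
    (p : (ℕ → Fin K → ℝ) × (ℕ → Fin K → ℝ)) : Prop :=
  ∃ s ≤ T, cycleCount (action sel α σ p.1 p.2) j s ≤ k ∧
    x ≤ ε * centeredReward sel α σ j μ s p

section

variable {sel : (Fin K → ℝ) → Fin K} (hsel : IsArgmax sel) (α σ : ℝ) (j : Fin K) (μ : ℝ)

include hsel in
lemma measurable_cycleCount_action (t : ℕ) :
    Measurable fun p : (ℕ → Fin K → ℝ) × (ℕ → Fin K → ℝ) =>
      cycleCount (action sel α σ p.1 p.2) j t :=
  (measurable_cycleCount j t).comp (measurable_action hsel α σ)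

include hsel in
lemma measurable_centeredReward (t : ℕ) : Measurable (centeredReward sel α σ j μ t) := by
  have h1 := (measurable_recordedReward j t (τ := fun _ => t) (fun _ => le_rfl)
    fun _ _ _ => rfl).comp (measurable_fst.prodMk (measurable_action hsel α σ))
  have h2 := (measurable_of_countable fun n : ℕ => (n : ℝ)).comp
    (measurable_cycleCount_action hsel α σ j t)
  exact h1.sub (h2.mul_const μ)

include hsel in
lemma measurableSet_exceeds (ε : ℝ) (k : ℕ) (x : ℝ) (T : ℕ) :
    MeasurableSet {p | Exceeds sel α σ j μ ε k x T p} := by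
  have : {p | Exceeds sel α σ j μ ε k x T p} = ⋃ s ∈ Finset.range (T + 1),
      {p | cycleCount (action sel α σ p.1 p.2) j s ≤ k} ∩
        {p | x ≤ ε * centeredReward sel α σ j μ s p} := by
    ext p
    simp only [Exceeds, Set.mem_ofPred_eq, Set.mem_iUnion, Finset.mem_range, Set.mem_inter_iff,
      exists_prop, Nat.lt_succ_iff]
  rw [this]
  refine Finset.measurableSet_biUnion _ fun s _ => MeasurableSet.inter ?_ ?_
  · exact measurable_cycleCount_action hsel α σ j s measurableSet_Iic
  · exact measurableSet_le measurable_const ((measurable_centeredReward hsel α σ j μ s).const_mul ε)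

lemma centeredReward_update_reward {s t : ℕ} (h : s < t) (v : Fin K → ℝ)
    (p : (ℕ → Fin K → ℝ) × (ℕ → Fin K → ℝ)) :
    centeredReward sel α σ j μ s (Function.update p.1 t v, p.2) =
      centeredReward sel α σ j μ s p := by
  have ha : ∀ u ≤ s, action sel α σ (Function.update p.1 t v) p.2 u = action sel α σ p.1 p.2 u :=
    fun u hu => action_update_reward sel α σ p.1 p.2 (by omega) v
  rw [centeredReward, centeredReward, cycleCount_congr j s ha,
    recordedReward_congr j s (fun u hu => Function.update_of_ne (by omega) _ _) ha]

lemma exceeds_update_reward (ε : ℝ) (k : ℕ) (x : ℝ) (t : ℕ) (v : Fin K → ℝ)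
    (p : (ℕ → Fin K → ℝ) × (ℕ → Fin K → ℝ)) :
    Exceeds sel α σ j μ ε k x t (Function.update p.1 (t + 1) v, p.2) ↔
      Exceeds sel α σ j μ ε k x t p := by
  refine exists_congr fun s => and_congr_right fun hs => ?_
  rw [centeredReward_update_reward α σ j μ (by omega),
    cycleCount_congr j s fun u hu => action_update_reward sel α σ p.1 p.2 (by omega) v]

/-- The exponential process `exp (l D - l² M / 8)`, where `D` is the centered reward times the sign
`ε` and `M` is the cycle count. It is a supermartingale for sub-Gaussian rewards. -/
noncomputable def expProcess (sel : (Fin K → ℝ) → Fin K) (α σ : ℝ) (j : Fin K) (μ ε l : ℝ) (t : ℕ)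
    (p : (ℕ → Fin K → ℝ) × (ℕ → Fin K → ℝ)) : ℝ≥0∞ :=
  ENNReal.ofReal (Real.exp (l * (ε * centeredReward sel α σ j μ t p) -
    l ^ 2 * cycleCount (action sel α σ p.1 p.2) j t / 8))

include hsel in
lemma measurable_expProcess (ε l : ℝ) (t : ℕ) :
    Measurable (expProcess sel α σ j μ ε l t) := by
  have h1 := measurable_centeredReward hsel α σ j μ t
  have h2 := (measurable_of_countable fun n : ℕ => (n : ℝ)).comp
    (measurable_cycleCount_action hsel α σ j t)
  exact (((h1.const_mul ε).const_mul l).sub ((h2.const_mul (l ^ 2)).div_const 8)).exp.ennreal_ofReal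

lemma expProcess_succ_update (ε l : ℝ) (t : ℕ) (v : Fin K → ℝ)
    (p : (ℕ → Fin K → ℝ) × (ℕ → Fin K → ℝ)) :
    expProcess sel α σ j μ ε l (t + 1) (Function.update p.1 (t + 1) v, p.2) =
      expProcess sel α σ j μ ε l t p *
        if Recorded (action sel α σ p.1 p.2) j (t + 1) then
          ENNReal.ofReal (Real.exp (l * ε * (v j - μ) - l ^ 2 / 8)) else 1 := by
  have ha : ∀ u ≤ t + 1, action sel α σ (Function.update p.1 (t + 1) v) p.2 u =
      action sel α σ p.1 p.2 u := fun u hu => action_update_reward sel α σ p.1 p.2 (by omega) v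
  have hr := recorded_congr j (t + 1) ha
  have hc := centeredReward_update_reward (sel := sel) α σ j μ (show t < t + 1 by omega) v p
  have hS : centeredReward sel α σ j μ (t + 1) (Function.update p.1 (t + 1) v, p.2) =
      centeredReward sel α σ j μ t p +
        if Recorded (action sel α σ p.1 p.2) j (t + 1) then v j - μ else 0 := by
    rw [← hc, centeredReward, centeredReward]
    simp only [recordedReward_succ, cycleCount_succ, hr, Function.update_self]
    split_ifs <;> push_cast <;> ring
  rw [expProcess, expProcess, hS, cycleCount_congr j (t + 1) ha, cycleCount_succ]
  split_ifs
  · rw [← ENNReal.ofReal_mul (Real.exp_pos _).le, ← Real.exp_add]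
    congr 2; push_cast; ring
  · simp

include hsel in
/-- Time-uniform Hoeffding inequality for the recorded rewards: a version of Ville's inequality
for `expProcess`, stopped when the centered reward first exceeds `x`. -/
lemma jointLaw_exceeds_le (ν : ℕ → Measure (Fin K → ℝ)) [∀ t, IsProbabilityMeasure (ν t)]
    (hν : ∀ t l, ∫⁻ v, ENNReal.ofReal (Real.exp (l * (v j - μ) - l ^ 2 / 8)) ∂(ν t) ≤ 1)
    {ε : ℝ} (hε : ε ^ 2 = 1) (k : ℕ) {x : ℝ} (hx : 0 ≤ x) (T : ℕ) :
    jointLaw ν {p | Exceeds sel α σ j μ ε k x T p} ≤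
      ENNReal.ofReal (Real.exp (-(2 * x ^ 2 / k))) := by
  rcases hx.eq_or_lt with rfl | hx
  · simpa using prob_le_one
  rcases Nat.eq_zero_or_pos k with rfl | hk
  · simpa using prob_le_one
  have hk' : (0 : ℝ) < k := by exact_mod_cast hk
  -- The optimal exponent in Chernoff's bound.
  let l : ℝ := 4 * x / k
  have hl : 0 < l := by positivity
  have hlx : l * x - l ^ 2 * k / 8 = 2 * x ^ 2 / k := by
    simp only [l]; field_simp; ring
  let c : ℝ≥0∞ := ENNReal.ofReal (Real.exp (2 * x ^ 2 / k))
  let S : ℕ → Set ((ℕ → Fin K → ℝ) × (ℕ → Fin K → ℝ)) :=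
    fun t => {p | Exceeds sel α σ j μ ε k x t p}
  have hS : ∀ t, MeasurableSet (S t) := fun t => measurableSet_exceeds hsel α σ j μ ε k x t
  classical
  let V : ℕ → (ℕ → Fin K → ℝ) × (ℕ → Fin K → ℝ) → ℝ≥0∞ := fun t =>
    (S t).piecewise (fun _ => c) (expProcess sel α σ j μ ε l t)
  have hV : ∀ t, ∫⁻ p, V t p ∂(jointLaw ν) ≤ 1 := by
    intro t
    induction t with
    | zero =>
      calc ∫⁻ p, V 0 p ∂(jointLaw ν) ≤ ∫⁻ _, 1 ∂(jointLaw ν) := by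
            refine lintegral_mono fun p => ?_
            have h0 : p ∉ S 0 := by
              rintro ⟨s, hs, -, h⟩
              obtain rfl : s = 0 := by omega
              simp [centeredReward] at h
              linarith
            simp only [V]
            rw [Set.piecewise_eq_of_notMem _ _ _ h0]
            simp [expProcess, centeredReward]
        _ = 1 := by simp
    | succ t ih =>
      let U : (ℕ → Fin K → ℝ) × (ℕ → Fin K → ℝ) → ℝ≥0∞ :=
        (S t).piecewise (fun _ => c) (expProcess sel α σ j μ ε l (t + 1))
      have hU : Measurable U :=
        Measurable.piecewise (hS t) measurable_const (measurable_expProcess hsel α σ j μ ε l _)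
      have hVU : ∀ p, V (t + 1) p ≤ U p := by
        intro p
        simp only [V, U]
        by_cases h : p ∈ S t
        · have h' : p ∈ S (t + 1) := by
            obtain ⟨s, hs, h⟩ := h
            exact ⟨s, by omega, h⟩
          rw [Set.piecewise_eq_of_mem _ _ _ h, Set.piecewise_eq_of_mem _ _ _ h']
        · rw [Set.piecewise_eq_of_notMem _ _ _ h]
          by_cases h' : p ∈ S (t + 1)
          · rw [Set.piecewise_eq_of_mem _ _ _ h']
            obtain ⟨s, hs, h1, h2⟩ := h'
            obtain rfl : s = t + 1 := by
              by_contra hne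
              exact h ⟨s, by omega, h1, h2⟩
            refine ENNReal.ofReal_le_ofReal (Real.exp_le_exp.2 ?_)
            rw [← hlx]
            have h1' : (cycleCount (action sel α σ p.1 p.2) j (t + 1) : ℝ) ≤ k := by
              exact_mod_cast h1
            gcongr
          · rw [Set.piecewise_eq_of_notMem _ _ _ h']
      refine le_trans ((lintegral_mono hVU).trans ?_) ih
      rw [lintegral_jointLaw_update_reward ν (t + 1) hU]
      refine lintegral_mono fun p => ?_
      have hmem : ∀ v, (Function.update p.1 (t + 1) v, p.2) ∈ S t ↔ p ∈ S t := fun v =>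
        exceeds_update_reward α σ j μ ε k x t v p
      simp only [U, V]
      by_cases h : p ∈ S t
      · rw [Set.piecewise_eq_of_mem _ _ _ h]
        refine (lintegral_congr fun v => Set.piecewise_eq_of_mem (S t) _ _ ((hmem v).2 h)).trans_le ?_
        simp
      · rw [Set.piecewise_eq_of_notMem _ _ _ h]
        refine (lintegral_congr fun v => (Set.piecewise_eq_of_notMem (S t) _ _
          (mt (hmem v).1 h)).trans (expProcess_succ_update α σ j μ ε l t v p)).trans_le ?_
        split_ifs
        · rw [lintegral_const_mul _ (by fun_prop)]
          have := hν (t + 1) (l * ε)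
          rw [mul_pow, hε, mul_one] at this
          exact (mul_le_mul_right this _).trans_eq (mul_one _)
        · simp
  have h1 : c * jointLaw ν (S T) ≤ 1 := by
    refine le_trans ?_ (hV T)
    rw [← setLIntegral_const, ← lintegral_indicator (hS T)]
    refine lintegral_mono fun p => ?_
    simp only [V, Set.indicator, Set.piecewise]
    split_ifs <;> simp
  have hc : ENNReal.ofReal (Real.exp (-(2 * x ^ 2 / k))) * c = 1 := by
    rw [← ENNReal.ofReal_mul (Real.exp_pos _).le, ← Real.exp_add]
    simp
  calc jointLaw ν (S T) = ENNReal.ofReal (Real.exp (-(2 * x ^ 2 / k))) * (c * jointLaw ν (S T)) := by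
        rw [← mul_assoc, hc, one_mul]
    _ ≤ _ := (mul_le_mul_right h1 _).trans_eq (mul_one _)

end

/-! ### Exponential moments of the recorded rewards -/

section

variable {sel : (Fin K → ℝ) → Fin K} (hsel : IsArgmax sel) (α σ : ℝ) (j : Fin K) (μ : ℝ)

/-- The absolute value of the centered reward of arm `j` is at least `x` at some time up to `T` at
which the arm has been recorded at most `k` times. -/
def Deviates (sel : (Fin K → ℝ) → Fin K) (α σ : ℝ) (j : Fin K) (μ : ℝ) (k : ℕ) (x : ℝ) (T : ℕ)
    (p : (ℕ → Fin K → ℝ) × (ℕ → Fin K → ℝ)) : Prop :=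
  Exceeds sel α σ j μ 1 k x T p ∨ Exceeds sel α σ j μ (-1) k x T p

variable {α σ j μ} in
lemma deviates_of_le_abs {k s T : ℕ} {x : ℝ} {p : (ℕ → Fin K → ℝ) × (ℕ → Fin K → ℝ)}
    (hs : s ≤ T) (hk : cycleCount (action sel α σ p.1 p.2) j s ≤ k)
    (hx : x ≤ |centeredReward sel α σ j μ s p|) : Deviates sel α σ j μ k x T p := by
  rcases abs_cases (centeredReward sel α σ j μ s p) with h | h
  · exact Or.inl ⟨s, hs, hk, by rw [one_mul]; linarith⟩
  · exact Or.inr ⟨s, hs, hk, by linarith⟩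

include hsel in
lemma measurableSet_deviates (k : ℕ) (x : ℝ) (T : ℕ) :
    MeasurableSet {p | Deviates sel α σ j μ k x T p} :=
  (measurableSet_exceeds hsel α σ j μ 1 k x T).union (measurableSet_exceeds hsel α σ j μ (-1) k x T)

include hsel in
lemma jointLaw_deviates_le (ν : ℕ → Measure (Fin K → ℝ)) [∀ t, IsProbabilityMeasure (ν t)]
    (hν : ∀ t l, ∫⁻ v, ENNReal.ofReal (Real.exp (l * (v j - μ) - l ^ 2 / 8)) ∂(ν t) ≤ 1)
    (k : ℕ) {x : ℝ} (hx : 0 ≤ x) (T : ℕ) :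
    jointLaw ν {p | Deviates sel α σ j μ k x T p} ≤
      2 * ENNReal.ofReal (Real.exp (-(2 * x ^ 2 / k))) := by
  rw [two_mul]
  exact (measure_union_le _ _).trans (add_le_add
    (jointLaw_exceeds_le hsel α σ j μ ν hν (by norm_num) k hx T)
    (jointLaw_exceeds_le hsel α σ j μ ν hν (by norm_num) k hx T))

open Classical in
/-- An upper bound for the largest value of `exp (9 D² / (5 k))` while arm `j` has been recorded at
most `k` times, where `D` is the centered reward. Summation is over the integer part of the
exponent. -/
noncomputable def peelSum (sel : (Fin K → ℝ) → Fin K) (α σ : ℝ) (j : Fin K) (μ : ℝ) (T k : ℕ)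
    (p : (ℕ → Fin K → ℝ) × (ℕ → Fin K → ℝ)) : ℝ≥0∞ :=
  ∑' n : ℕ, {p | Deviates sel α σ j μ k √(5 * k * n / 9) T p}.indicator
    (fun _ => ENNReal.ofReal (Real.exp (n + 1))) p

lemma exp_le_peelSum {k s T : ℕ} {p : (ℕ → Fin K → ℝ) × (ℕ → Fin K → ℝ)}
    (hs : s ≤ T) (hk : cycleCount (action sel α σ p.1 p.2) j s ≤ k) :
    ENNReal.ofReal (Real.exp (9 / 5 * centeredReward sel α σ j μ s p ^ 2 / k)) ≤
      peelSum sel α σ j μ T k p := by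
  set D := centeredReward sel α σ j μ s p with hD
  have h0 : 0 ≤ 9 / 5 * D ^ 2 / k := by positivity
  have h1 := Nat.floor_le h0
  have h2 := (Nat.lt_floor_add_one (9 / 5 * D ^ 2 / k)).le
  set n := ⌊9 / 5 * D ^ 2 / k⌋₊
  have hx : √(5 * k * n / 9) ≤ |D| := by
    rw [← Real.sqrt_sq_eq_abs]
    refine Real.sqrt_le_sqrt ?_
    rcases Nat.eq_zero_or_pos k with rfl | hk
    · simp [sq_nonneg]
    · have hk' : (0 : ℝ) < k := by exact_mod_cast hk
      rw [le_div_iff₀ hk'] at h1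
      linarith
  refine le_trans ?_ (ENNReal.le_tsum n)
  rw [Set.indicator_of_mem (show p ∈ {p | Deviates sel α σ j μ k √(5 * k * n / 9) T p} from
    deviates_of_le_abs hs hk hx)]
  exact ENNReal.ofReal_le_ofReal (Real.exp_le_exp.2 h2)

include hsel in
lemma measurable_peelSum (T k : ℕ) : Measurable (peelSum sel α σ j μ T k) :=
  Measurable.tsum fun _ =>
    measurable_const.indicator (measurableSet_deviates hsel α σ j μ _ _ _)

include hsel in
lemma lintegral_peelSum_le (ν : ℕ → Measure (Fin K → ℝ)) [∀ t, IsProbabilityMeasure (ν t)]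
    (hν : ∀ t l, ∫⁻ v, ENNReal.ofReal (Real.exp (l * (v j - μ) - l ^ 2 / 8)) ∂(ν t) ≤ 1)
    (T : ℕ) {k : ℕ} (hk : 1 ≤ k) :
    ∫⁻ p, peelSum sel α σ j μ T k p ∂(jointLaw ν) ≤ 60 := by
  have hk' : (0 : ℝ) < k := by exact_mod_cast hk
  have hterm : ∀ n : ℕ, ∫⁻ p, {p | Deviates sel α σ j μ k √(5 * k * n / 9) T p}.indicator
      (fun _ => ENNReal.ofReal (Real.exp (n + 1))) p ∂(jointLaw ν) ≤
        6 * ENNReal.ofReal (9 / 10) ^ n := by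
    intro n
    rw [lintegral_indicator_const (measurableSet_deviates hsel α σ j μ _ _ _)]
    refine (mul_le_mul_right
      (jointLaw_deviates_le hsel α σ j μ ν hν k (Real.sqrt_nonneg _) T) _).trans ?_
    rw [Real.sq_sqrt (by positivity), show (6 : ℝ≥0∞) = ENNReal.ofReal 6 by simp,
      show (2 : ℝ≥0∞) = ENNReal.ofReal 2 by simp, ← ENNReal.ofReal_pow (by norm_num),
      ← ENNReal.ofReal_mul (by norm_num), ← ENNReal.ofReal_mul (Real.exp_pos _).le,
      ← ENNReal.ofReal_mul (by norm_num)]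
    refine ENNReal.ofReal_le_ofReal ?_
    have e1 : 2 * (5 * k * n / 9) / k = 10 / 9 * (n : ℝ) := by field_simp; ring
    have e2 : Real.exp (n + 1) * (2 * Real.exp (-(10 / 9 * (n : ℝ)))) =
        2 * Real.exp 1 * Real.exp (-(1 / 9)) ^ n := by
      rw [← Real.exp_nat_mul, mul_left_comm, ← Real.exp_add, mul_assoc, ← Real.exp_add]
      congr 2; ring
    have e3 : Real.exp (-(1 / 9)) ≤ 9 / 10 := by
      rw [Real.exp_neg, inv_le_comm₀ (Real.exp_pos _) (by norm_num)]
      have := Real.add_one_le_exp (1 / 9 : ℝ)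
      norm_num at this ⊢
      linarith
    have e4 := Real.exp_one_lt_d9
    rw [e1, e2]
    gcongr
    linarith
  calc ∫⁻ p, peelSum sel α σ j μ T k p ∂(jointLaw ν)
      = ∑' n : ℕ, ∫⁻ p, {p | Deviates sel α σ j μ k √(5 * k * n / 9) T p}.indicator
          (fun _ => ENNReal.ofReal (Real.exp (n + 1))) p ∂(jointLaw ν) :=
        lintegral_tsum fun n => (measurable_const.indicator
          (measurableSet_deviates hsel α σ j μ _ _ _)).aemeasurable
    _ ≤ ∑' n : ℕ, 6 * ENNReal.ofReal (9 / 10) ^ n := ENNReal.tsum_le_tsum hterm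
    _ = 6 * (1 - ENNReal.ofReal (9 / 10))⁻¹ := by rw [ENNReal.tsum_mul_left, ENNReal.tsum_geometric]
    _ = 60 := by
        rw [← ENNReal.ofReal_one, ← ENNReal.ofReal_sub _ (by norm_num),
          ← ENNReal.ofReal_inv_of_pos (by norm_num), show (6 : ℝ≥0∞) = ENNReal.ofReal 6 by simp,
          ← ENNReal.ofReal_mul (by norm_num)]
        norm_num

/-! ### The posterior of a batch -/

/-- The mean of the sampling distribution of arm `i` at time `t`. -/
noncomputable def postMean (α : ℝ) (y : ℕ → Fin K → ℝ) (a : ℕ → Fin K) (t : ℕ) (i : Fin K) : ℝ :=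
  recordedReward y a i (lastBatchEnd α a (t - 1)) /
    (1 + (cycleCount a i (lastBatchEnd α a (t - 1)) : ℝ))

/-- The standard deviation of the sampling distribution of arm `i` at time `t`. -/
noncomputable def postSd (α σ : ℝ) (a : ℕ → Fin K) (t : ℕ) (i : Fin K) : ℝ :=
  σ / √(1 + (cycleCount a i (lastBatchEnd α a (t - 1)) : ℝ))

lemma sample_eq (α σ : ℝ) (y z : ℕ → Fin K → ℝ) (a : ℕ → Fin K) (t : ℕ) :
    sample α σ y z a t = fun i => postMean α y a t i + postSd α σ a t i * z t i := rfl

variable {σ} in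
lemma postSd_pos (hσ : 0 < σ) (a : ℕ → Fin K) (t : ℕ) (i : Fin K) : 0 < postSd α σ a t i := by
  unfold postSd; positivity

lemma postMean_congr {y y' : ℕ → Fin K → ℝ} {a b : ℕ → Fin K} (i : Fin K) {t : ℕ} (ht : 1 ≤ t)
    (hy : ∀ s < t, y s = y' s) (h : ∀ s < t, a s = b s) :
    postMean α y a t i = postMean α y' b t i := by
  have h' : ∀ s ≤ t - 1, a s = b s := fun s hs => h s (by omega)
  have hl := lastBatchEnd_le α b (t - 1)
  rw [postMean, postMean, lastBatchEnd_congr α _ h',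
    cycleCount_congr i _ fun s hs => h' s (hs.trans hl),
    recordedReward_congr i _ (fun s hs => hy s (by omega)) fun s hs => h' s (hs.trans hl)]

lemma postSd_congr {a b : ℕ → Fin K} (i : Fin K) {t : ℕ} (ht : 1 ≤ t) (h : ∀ s < t, a s = b s) :
    postSd α σ a t i = postSd α σ b t i := by
  have h' : ∀ s ≤ t - 1, a s = b s := fun s hs => h s (by omega)
  have hl := lastBatchEnd_le α b (t - 1)
  rw [postSd, postSd, lastBatchEnd_congr α _ h',
    cycleCount_congr i _ fun s hs => h' s (hs.trans hl)]

/-- The reciprocal tail bound at the distance of the posterior mean of arm `i` from `μ`. -/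
noncomputable def cost (sel : (Fin K → ℝ) → Fin K) (α σ : ℝ) (i : Fin K) (μ : ℝ) (t : ℕ)
    (p : (ℕ → Fin K → ℝ) × (ℕ → Fin K → ℝ)) : ℝ≥0∞ :=
  invTail (|postMean α p.1 (action sel α σ p.1 p.2) t i - μ| /
    postSd α σ (action sel α σ p.1 p.2) t i)

include hsel in
lemma measurable_postMean (t : ℕ) (i : Fin K) :
    Measurable fun p : (ℕ → Fin K → ℝ) × (ℕ → Fin K → ℝ) =>
      postMean α p.1 (action sel α σ p.1 p.2) t i := by
  have ha := measurable_action hsel α σ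
  have h1 := (measurable_recordedReward_lastBatchEnd α i (t - 1)).comp (measurable_fst.prodMk ha)
  have h2 := (measurable_cycleCount_lastBatchEnd α i (t - 1)).comp ha
  exact h1.div ((measurable_of_countable fun n : ℕ => (1 + n : ℝ)).comp h2)

include hsel in
lemma measurable_cost (t : ℕ) (i : Fin K) : Measurable (cost sel α σ i μ t) := by
  have h2 := (measurable_cycleCount_lastBatchEnd α i (t - 1)).comp (measurable_action hsel α σ)
  have h3 := (measurable_of_countable fun n : ℕ => σ / √(1 + n : ℝ)).comp h2
  exact measurable_invTail.comp (((measurable_postMean hsel α σ t i).sub_const μ).abs.div h3)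

/-- The square of `cost` has bounded expectation at fixed cycle count: the growth of the cycle count
within a batch costs a factor `α`, which the condition `α ≤ 5 σ² / 4` absorbs. -/
lemma cost_sq_le_peelSum {α σ μ : ℝ} {T t k : ℕ} (hα : 1 < α) (hσ : 0 < σ)
    (hασ : α ≤ 5 * σ ^ 2 / 4) (hμ : μ ∈ Set.Icc (0 : ℝ) 1)
    (htT : t ≤ T) (p : (ℕ → Fin K → ℝ) × (ℕ → Fin K → ℝ))
    (hk : cycleCount (action sel α σ p.1 p.2) j (t - 1) = k) :
    cost sel α σ j μ t p ^ 2 ≤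
      ENNReal.ofReal (9 * Real.exp 15) * peelSum sel α σ j μ T (max k 1) p := by
  set a := action sel α σ p.1 p.2 with ha
  set B := lastBatchEnd α a (t - 1) with hB
  have hBle : B ≤ t - 1 := lastBatchEnd_le α a (t - 1)
  set m : ℝ := ((cycleCount a j B : ℕ) : ℝ) with hm
  have hm0 : 0 ≤ m := Nat.cast_nonneg _
  set S := recordedReward p.1 a j B with hS
  have hD : centeredReward sel α σ j μ B p = S - m * μ := rfl
  -- For `k = 0` there is no recorded reward yet, and the exponent is `0`.
  set N := max k 1
  have hN1 : (1 : ℝ) ≤ N := by exact_mod_cast le_max_right k 1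
  have hNle : (N : ℝ) ≤ 5 / 4 * σ ^ 2 * (1 + m) := by
    have h1 := cycleCount_le_mul_lastBatchEnd (a := a) hα (t - 1) j
    rw [hk, ← hB, ← hm] at h1
    have h2 : (N : ℝ) ≤ α * (1 + m) := by
      rw [Nat.cast_max, max_le_iff, Nat.cast_one]
      constructor <;> nlinarith
    exact h2.trans (by nlinarith)
  have hu : (|S / (1 + m) - μ| / (σ / √(1 + m))) ^ 2 = (S - m * μ - μ) ^ 2 / (σ ^ 2 * (1 + m)) := by
    rw [div_pow, sq_abs, div_pow, Real.sq_sqrt (by positivity)]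
    field_simp
    ring
  have hu0 : 0 ≤ |S / (1 + m) - μ| / (σ / √(1 + m)) := by positivity
  -- Each square of a sum loses a factor `6 / 5`, so that the exponent `5 / 4` becomes `9 / 5`.
  have hkey : (|S / (1 + m) - μ| / (σ / √(1 + m)) + 1) ^ 2 ≤
      15 + 9 / 5 * (S - m * μ) ^ 2 / N := by
    set u := |S / (1 + m) - μ| / (σ / √(1 + m))
    have h1 : (u + 1) ^ 2 ≤ 6 / 5 * u ^ 2 + 6 := by nlinarith [sq_nonneg (u - 5)]
    have h2 : u ^ 2 ≤ 5 / 4 * (6 / 5 * (S - m * μ) ^ 2 + 6) / N := by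
      rw [hu, div_le_div_iff₀ (by positivity) (by positivity)]
      have h3 : (S - m * μ - μ) ^ 2 ≤ 6 / 5 * (S - m * μ) ^ 2 + 6 := by
        nlinarith [sq_nonneg (S - m * μ + 5 * μ), hμ.1, hμ.2, mul_nonneg hμ.1 (sub_nonneg.2 hμ.2)]
      calc (S - m * μ - μ) ^ 2 * N ≤ (6 / 5 * (S - m * μ) ^ 2 + 6) * (5 / 4 * σ ^ 2 * (1 + m)) := by
            gcongr
        _ = _ := by ring
    have h4 : 5 / 4 * (6 / 5 * (S - m * μ) ^ 2 + 6) / N = 3 / 2 * (S - m * μ) ^ 2 / N + 15 / 2 / N := by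
      ring
    have h5 : (15 / 2 : ℝ) / N ≤ 15 / 2 := div_le_self (by norm_num) hN1
    have h6 : 9 / 5 * (S - m * μ) ^ 2 / N = 6 / 5 * (3 / 2 * (S - m * μ) ^ 2 / N) := by ring
    rw [h6]
    linarith
  have hcost : cost sel α σ j μ t p ^ 2 =
      ENNReal.ofReal (9 * Real.exp ((|S / (1 + m) - μ| / (σ / √(1 + m)) + 1) ^ 2)) := by
    rw [cost, invTail, ← ENNReal.ofReal_pow (by positivity), mul_pow, ← Real.exp_nat_mul]
    simp only [postMean, postSd, ← ha, ← hB, ← hS, ← hm]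
    congr 2
    · norm_num
    · congr 1; push_cast; ring
  rw [hcost]
  refine le_trans ?_ (mul_le_mul_right (exp_le_peelSum α σ j μ (s := B) (by omega) ?_) _)
  · rw [← ENNReal.ofReal_mul (by positivity), mul_assoc, ← Real.exp_add, hD]
    exact ENNReal.ofReal_le_ofReal (by gcongr)
  · exact (cycleCount_mono a j hBle).trans (hk.trans_le (le_max_left _ _))

end

/-! ### The charging inequality -/

/-- The conditional probability of playing the suboptimal arm `i` rather than the best arm `b`, for
a posterior with means `m` and standard deviations `s`. In the application `Ri` and `Rb` say that
a cycle of arm `i` or `b` is running, `Hi` and `Hb` that the cycle count of the arm is small, and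
`Good` that well-explored arms have accurate posterior means. Outside the events of small
probability, the plays of `i` are charged to plays of `b` that are recorded, to plays that end
a cycle of `i`, and to plays of `i` that are themselves few. -/
lemma noiseLaw_play_le {sel : (Fin K → ℝ) → Fin K} (hsel : IsArgmax sel) (m s : Fin K → ℝ)
    {i b : Fin K} (hib : i ≠ b) {y : ℝ} {F G ε : ℝ≥0∞} (Good Ri Rb Hi Hb : Prop)
    [Decidable Good] [Decidable Ri] [Decidable Rb] [Decidable Hi] [Decidable Hb]
    (hG1 : 1 ≤ G) (hF1 : 1 ≤ F)
    (hG : 1 ≤ G * gaussianReal 0 1 {x | y < m b + s b * x})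
    (hF : 1 ≤ F * gaussianReal 0 1 {x | m i + s i * x ≤ y})
    (hi : Good → ¬ Hi → gaussianReal 0 1 {x | y < m i + s i * x} ≤ ε)
    (hb : Good → ¬ Hb → gaussianReal 0 1 {x | m b + s b * x ≤ y} ≤ ε) (hε : ε ≤ 2⁻¹) :
    noiseLaw K {w | sel (fun j => m j + s j * w j) = i} ≤
      ((if Good then 0 else 1) + 2 * ε) +
      ((if Rb ∧ Hb then 1 else 0) + if ¬ Ri ∧ Hi then 1 else 0) *
        noiseLaw K {w | sel (fun j => m j + s j * w j) = i} +
      (if ¬ Rb ∧ Hb then 2 * G ^ 2 else 0) *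
        noiseLaw K {w | sel (fun j => m j + s j * w j) = b} +
      (if Ri ∧ Hi then 3 * F ^ 2 else 0) *
        noiseLaw K {w | sel (fun j => m j + s j * w j) ≠ i} := by
  have hle := noiseLaw_play_le_le hsel m s (i := i) hG
  have hgt := noiseLaw_play_gt_le (sel := sel) m s (i := i) hF
  have hle' := noiseLaw_play_le_le_eval hsel m s (i := i) (b := b) (y := y)
  have hgt' := noiseLaw_play_gt_le_eval (sel := sel) m s (i := i) (y := y)
  have hsplit : noiseLaw K {w | sel (fun j => m j + s j * w j) = i} ≤
      noiseLaw K {w | sel (fun j => m j + s j * w j) = i ∧ m i + s i * w i ≤ y} +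
      noiseLaw K {w | sel (fun j => m j + s j * w j) = i ∧ y < m i + s i * w i} := by
    refine (measure_mono fun w hw => ?_).trans (measure_union_le _ _)
    rcases le_or_gt (m i + s i * w i) y with h | h
    · exact Or.inl ⟨hw, h⟩
    · exact Or.inr ⟨hw, h⟩
  have hbi : noiseLaw K {w | sel (fun j => m j + s j * w j) = b} ≤
      noiseLaw K {w | sel (fun j => m j + s j * w j) ≠ i} :=
    measure_mono fun w hw h => hib (h.symm.trans hw)
  -- A well-explored best arm exceeds `y` with probability at least `1 / 2`.
  have hle2 : ∀ h : Good, ¬ Hb →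
      noiseLaw K {w | sel (fun j => m j + s j * w j) = i ∧ m i + s i * w i ≤ y} ≤
        2 * noiseLaw K {w | sel (fun j => m j + s j * w j) = b} := by
    intro hgood hHb
    refine noiseLaw_play_le_le hsel m s ?_
    have h1 : (1 : ℝ≥0∞) ≤ gaussianReal 0 1 {x | m b + s b * x ≤ y} +
        gaussianReal 0 1 {x | y < m b + s b * x} := by
      rw [← measure_univ (μ := gaussianReal 0 1)]
      refine (measure_mono fun x _ => ?_).trans (measure_union_le _ _)
      exact le_or_gt (m b + s b * x) y
    have h2 : (1 : ℝ≥0∞) + 1 ≤ 1 + 2 * gaussianReal 0 1 {x | y < m b + s b * x} := by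
      calc (1 : ℝ≥0∞) + 1 = 2 * 1 := by norm_num
        _ ≤ 2 * (2⁻¹ + gaussianReal 0 1 {x | y < m b + s b * x}) := by
            gcongr
            exact h1.trans (add_le_add_left ((hb hgood hHb).trans hε) _)
        _ = _ := by rw [mul_add, ENNReal.mul_inv_cancel (by norm_num) (by norm_num)]
    exact ENNReal.le_of_add_le_add_left ENNReal.one_ne_top h2
  generalize noiseLaw K {w | sel (fun j => m j + s j * w j) = i ∧ m i + s i * w i ≤ y} = q at *
  generalize noiseLaw K {w | sel (fun j => m j + s j * w j) = i ∧ y < m i + s i * w i} = q' at *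
  generalize hp : noiseLaw K {w | sel (fun j => m j + s j * w j) = i} = p at *
  have hp1 : p ≤ 1 := hp ▸ prob_le_one
  generalize noiseLaw K {w | sel (fun j => m j + s j * w j) = b} = pb at *
  generalize noiseLaw K {w | sel (fun j => m j + s j * w j) ≠ i} = n at *
  have hFF : F ≤ F ^ 2 := by rw [sq]; exact le_mul_of_one_le_left' hF1
  have hGG : G ≤ G ^ 2 := by rw [sq]; exact le_mul_of_one_le_left' hG1
  have hFG : F * G ≤ G ^ 2 + F ^ 2 := by
    rcases le_total F G with h | h
    · rw [sq G]; exact (mul_le_mul_left h G).trans le_self_add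
    · rw [sq F]; exact (mul_le_mul_right h F).trans le_add_self
  by_cases hgood : Good
  swap
  · rw [if_neg hgood]
    exact le_add_right (le_add_right (le_add_right (le_add_right hp1)))
  by_cases h1 : Rb ∧ Hb
  · rw [if_pos h1]
    calc p = 1 * p := (one_mul p).symm
      _ ≤ (1 + if ¬ Ri ∧ Hi then 1 else 0) * p := by gcongr; exact le_self_add
      _ ≤ _ := le_add_right (le_add_right le_add_self)
  by_cases h2 : ¬ Ri ∧ Hi
  · rw [if_pos h2]
    calc p = 1 * p := (one_mul p).symm
      _ ≤ ((if Rb ∧ Hb then 1 else 0) + 1) * p := by gcongr; exact le_add_self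
      _ ≤ _ := le_add_right (le_add_right le_add_self)
  rw [if_pos hgood, if_neg h1, if_neg h2, zero_add, add_zero, zero_mul, add_zero]
  by_cases hHb : Hb <;> by_cases hHi : Hi
  · rw [if_pos ⟨fun h => h1 ⟨h, hHb⟩, hHb⟩, if_pos ⟨not_not.1 fun h => h2 ⟨h, hHi⟩, hHi⟩]
    calc p ≤ q + q' := hsplit
      _ ≤ G * pb + F * (G * pb + n) := by gcongr; exact hgt.trans (by gcongr)
      _ = G * pb + (F * G) * pb + F * n := by ring
      _ ≤ G ^ 2 * pb + (G ^ 2 + F ^ 2) * pb + F ^ 2 * n := by gcongr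
      _ = 2 * G ^ 2 * pb + (F ^ 2 * pb + F ^ 2 * n) := by ring
      _ ≤ 2 * G ^ 2 * pb + (F ^ 2 * n + F ^ 2 * n) := by gcongr
      _ ≤ 2 * G ^ 2 * pb + 3 * F ^ 2 * n := by
          gcongr
          rw [← two_mul, mul_assoc]
          gcongr
          norm_num
      _ ≤ _ := by gcongr; exact le_add_self
  · rw [if_pos ⟨fun h => h1 ⟨h, hHb⟩, hHb⟩]
    calc p ≤ q + q' := hsplit
      _ ≤ G * pb + ε := by gcongr; exact hgt'.trans (hi hgood hHi)
      _ ≤ G ^ 2 * pb + ε := by gcongr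
      _ ≤ 2 * G ^ 2 * pb + 2 * ε := by
          rw [mul_assoc]
          exact add_le_add (le_mul_of_one_le_left' one_le_two) (le_mul_of_one_le_left' one_le_two)
      _ ≤ _ := by rw [add_comm]; exact le_self_add
  · rw [if_pos (⟨not_not.1 fun h => h2 ⟨h, hHi⟩, hHi⟩ : Ri ∧ Hi)]
    calc p ≤ q + q' := hsplit
      _ ≤ ε + F * (2 * n + n) := by
          gcongr
          · exact hle'.trans (hb hgood hHb)
          · exact hgt.trans (by gcongr; exact (hle2 hgood hHb).trans (by gcongr))
      _ = ε + 3 * F * n := by ring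
      _ ≤ 2 * ε + 3 * F ^ 2 * n := by
          gcongr
          exact le_mul_of_one_le_left' (by norm_num)
      _ ≤ _ := by gcongr; exact le_self_add
  · calc p ≤ q + q' := hsplit
      _ ≤ ε + ε := add_le_add (hle'.trans (hb hgood hHb)) (hgt'.trans (hi hgood hHi))
      _ = 2 * ε := (two_mul ε).symm
      _ ≤ _ := by rw [add_assoc]; exact le_self_add

/-! ### Counting along the cycle counts -/

/-- A sum over the times at which an event happens is a sum over the values of a counter that
increases strictly from one occurrence to the next. -/
lemma sum_le_sum_of_strictMonoOn {T L : ℕ} {E : ℕ → Prop} [DecidablePred E] {c : ℕ → ℕ}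
    {φ Ψ : ℕ → ℝ≥0∞} (hc : ∀ t t', 1 ≤ t → t < t' → E t → E t' → c t < c t')
    (hφ : ∀ t ∈ Finset.Icc 1 T, E t → φ t ≤ Ψ (c t)) :
    ∑ t ∈ Finset.Icc 1 T, (if E t ∧ c t < L then φ t else 0) ≤ ∑ k ∈ Finset.range L, Ψ k := by
  rw [← Finset.sum_filter]
  set A := (Finset.Icc 1 T).filter fun t => E t ∧ c t < L
  have hinj : Set.InjOn c A := by
    intro t ht t' ht' h
    simp only [A, Finset.coe_filter, Finset.mem_Icc, Set.mem_ofPred_eq] at ht ht'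
    by_contra hne
    rcases Nat.lt_or_gt_of_ne hne with hlt | hlt
    · exact (hc t t' ht.1.1 hlt ht.2.1 ht'.2.1).ne h
    · exact (hc t' t ht'.1.1 hlt ht'.2.1 ht.2.1).ne h.symm
  calc ∑ t ∈ A, φ t ≤ ∑ t ∈ A, Ψ (c t) := Finset.sum_le_sum fun t ht =>
        hφ t (Finset.mem_filter.1 ht).1 (Finset.mem_filter.1 ht).2.1
    _ = ∑ k ∈ A.image c, Ψ k := (Finset.sum_image hinj).symm
    _ ≤ ∑ k ∈ Finset.range L, Ψ k := Finset.sum_le_sum_of_subset fun k hk => by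
        obtain ⟨t, ht, rfl⟩ := Finset.mem_image.1 hk
        exact Finset.mem_range.2 (Finset.mem_filter.1 ht).2.2

/-! ### Accuracy of the posterior means of well-explored arms -/

/-- If the posterior of arm `j` at time `t` is based on at least `n` recorded rewards, then its mean
is within `d` of `μ`. -/
def Accurate (sel : (Fin K → ℝ) → Fin K) (α σ : ℝ) (j : Fin K) (μ n d : ℝ) (t : ℕ)
    (p : (ℕ → Fin K → ℝ) × (ℕ → Fin K → ℝ)) : Prop :=
  n ≤ (cycleCount (action sel α σ p.1 p.2) j
    (lastBatchEnd α (action sel α σ p.1 p.2) (t - 1)) : ℝ) →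
  |postMean α p.1 (action sel α σ p.1 p.2) t j - μ| ≤ d

noncomputable instance (sel : (Fin K → ℝ) → Fin K) (α σ : ℝ) (j : Fin K) (μ n d : ℝ) (t : ℕ)
    (p : (ℕ → Fin K → ℝ) × (ℕ → Fin K → ℝ)) : Decidable (Accurate sel α σ j μ n d t p) :=
  Classical.propDecidable _

section

variable {sel : (Fin K → ℝ) → Fin K} (hsel : IsArgmax sel) (α σ : ℝ) (j : Fin K) (μ n d : ℝ)

include hsel in
lemma measurableSet_accurate (t : ℕ) : MeasurableSet {p | Accurate sel α σ j μ n d t p} := by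
  have h2 := (measurable_of_countable fun n : ℕ => (n : ℝ)).comp
    ((measurable_cycleCount_lastBatchEnd α j (t - 1)).comp (measurable_action hsel α σ))
  have h1 : MeasurableSet {p : (ℕ → Fin K → ℝ) × (ℕ → Fin K → ℝ) |
      n ≤ (cycleCount (action sel α σ p.1 p.2) j
        (lastBatchEnd α (action sel α σ p.1 p.2) (t - 1)) : ℝ)} :=
    measurableSet_le measurable_const h2
  have h3 : MeasurableSet {p : (ℕ → Fin K → ℝ) × (ℕ → Fin K → ℝ) |
      |postMean α p.1 (action sel α σ p.1 p.2) t j - μ| ≤ d} :=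
    measurableSet_le ((measurable_postMean hsel α σ t j).sub_const μ).abs measurable_const
  exact h1.imp h3

/-- An inaccurate posterior mean forces a deviation of the recorded rewards at some cycle count. -/
lemma exists_deviates_of_not_accurate {α σ μ n d : ℝ} {j : Fin K} {t T : ℕ} (htT : t ≤ T)
    (hμ : μ ∈ Set.Icc (0 : ℝ) 1) (hd : 0 ≤ d) (hnd : 2 ≤ n * d)
    {p : (ℕ → Fin K → ℝ) × (ℕ → Fin K → ℝ)} (h : ¬ Accurate sel α σ j μ n d t p) :
    ∃ k ∈ Finset.range (T + 1), n ≤ (k : ℝ) ∧ Deviates sel α σ j μ k (k * d / 2) T p := by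
  rw [Accurate, Classical.not_imp, not_le] at h
  set a := action sel α σ p.1 p.2 with ha
  set B := lastBatchEnd α a (t - 1) with hB
  have hBle : B ≤ t - 1 := lastBatchEnd_le α a (t - 1)
  refine ⟨cycleCount a j B, ?_, h.1, ?_⟩
  · have := cycleCount_le a j B
    rw [Finset.mem_range]; omega
  refine deviates_of_le_abs (s := B) (by omega) le_rfl ?_
  obtain ⟨h1, h2⟩ := h
  simp only [postMean, ← hB] at h2
  have hD : centeredReward sel α σ j μ B p =
      recordedReward p.1 a j B - cycleCount a j B * μ := rfl
  rw [hD]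
  set m : ℝ := ((cycleCount a j B : ℕ) : ℝ) with hm
  have hm0 : 0 ≤ m := Nat.cast_nonneg _
  have e : recordedReward p.1 a j B / (1 + m) - μ =
      (recordedReward p.1 a j B - m * μ - μ) / (1 + m) := by field_simp; ring
  rw [e, abs_div, abs_of_pos (show 0 < 1 + m by positivity), lt_div_iff₀ (by positivity)] at h2
  have h3 := abs_sub (recordedReward p.1 a j B - m * μ) μ
  rw [abs_of_nonneg hμ.1] at h3
  have h4 : n * d ≤ m * d := mul_le_mul_of_nonneg_right h1 hd
  have := hμ.2
  nlinarith

include hsel in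
/-- The threshold `96 log T / Δ²` makes the deviation probability at each cycle count at
most `2 / T³`. -/
lemma jointLaw_not_accurate_le (ν : ℕ → Measure (Fin K → ℝ)) [∀ t, IsProbabilityMeasure (ν t)]
    {j : Fin K} {μ : ℝ} (hμ : μ ∈ Set.Icc (0 : ℝ) 1)
    (hν : ∀ t l, ∫⁻ v, ENNReal.ofReal (Real.exp (l * (v j - μ) - l ^ 2 / 8)) ∂(ν t) ≤ 1)
    {α σ n Δ : ℝ} {t T : ℕ} (htT : t ≤ T) (hT : 2 ≤ T) (hΔ : 0 < Δ) (hΔ1 : Δ ≤ 1)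
    (hn : 96 * Real.log T / Δ ^ 2 ≤ n) :
    jointLaw ν {p | ¬ Accurate sel α σ j μ n (Δ / 4) t p} ≤
      ENNReal.ofReal (2 * (T + 1) / T ^ 3) := by
  have hT0 : (0 : ℝ) < T := by positivity
  have hlog : 1 / 2 ≤ Real.log T := by
    have h1 := Real.log_two_gt_d9
    have h2 := Real.log_le_log (by norm_num) (show (2 : ℝ) ≤ T by exact_mod_cast hT)
    linarith
  rw [div_le_iff₀ (by positivity)] at hn
  have hnd : 2 ≤ n * (Δ / 4) := by
    by_contra hcon
    nlinarith
  have hsub : {p | ¬ Accurate sel α σ j μ n (Δ / 4) t p} ⊆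
      ⋃ k ∈ Finset.range (T + 1),
        {p | n ≤ (k : ℝ) ∧ Deviates sel α σ j μ k (k * (Δ / 4) / 2) T p} := by
    intro p hp
    obtain ⟨k, hk, h⟩ := exists_deviates_of_not_accurate htT hμ (by positivity) hnd hp
    exact Set.mem_biUnion hk h
  refine (measure_mono hsub).trans ((measure_biUnion_finset_le _ _).trans ?_)
  have hk : ∀ k ∈ Finset.range (T + 1),
      jointLaw ν {p | n ≤ (k : ℝ) ∧ Deviates sel α σ j μ k (k * (Δ / 4) / 2) T p} ≤
        ENNReal.ofReal (2 / T ^ 3) := by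
    intro k _
    by_cases hnk : n ≤ (k : ℝ)
    · simp only [hnk, true_and]
      refine (jointLaw_deviates_le hsel α σ j μ ν hν k (by positivity) T).trans ?_
      rw [show (2 : ℝ≥0∞) = ENNReal.ofReal 2 by simp, ← ENNReal.ofReal_mul (by norm_num),
        div_eq_mul_inv (2 : ℝ) (T ^ 3 : ℝ)]
      refine ENNReal.ofReal_le_ofReal (mul_le_mul_of_nonneg_left ?_ (by norm_num))
      rw [← Real.exp_log (show (0 : ℝ) < (T ^ 3 : ℝ)⁻¹ by positivity), Real.log_inv, Real.log_pow,
        Real.exp_le_exp, neg_le_neg_iff]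
      have hk0 : (0 : ℝ) < k := by
        have : 0 < n := by by_contra hcon; nlinarith
        linarith
      have : 2 * (k * (Δ / 4) / 2) ^ 2 / k = k * Δ ^ 2 / 32 := by field_simp; ring
      rw [this]
      push_cast
      nlinarith [sq_nonneg Δ, mul_le_mul_of_nonneg_right hnk (sq_nonneg Δ)]
    · simp [hnk]
  refine (Finset.sum_le_sum hk).trans_eq ?_
  rw [Finset.sum_const, Finset.card_range, nsmul_eq_mul, ← ENNReal.ofReal_natCast,
    ← ENNReal.ofReal_mul (by positivity)]
  congr 1; push_cast; ring

/-- The tail bound for an arm with many recorded rewards and an accurate posterior mean. -/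
lemma exp_neg_postSd_le {α σ n Δ : ℝ} {t T : ℕ} {a : ℕ → Fin K} {j : Fin K} (hσ : 0 < σ)
    (hΔ : 0 < Δ) (hT : 2 ≤ T) (hn : 32 * σ ^ 2 * Real.log T / Δ ^ 2 ≤ n)
    (hm : n ≤ (cycleCount a j (lastBatchEnd α a (t - 1)) : ℝ)) :
    ENNReal.ofReal (Real.exp (-((Δ / 4 / postSd α σ a t j) ^ 2 / 2))) ≤
      ENNReal.ofReal (1 / T) := by
  have hT0 : (0 : ℝ) < T := by positivity
  refine ENNReal.ofReal_le_ofReal ?_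
  rw [one_div, ← Real.exp_log (show (0 : ℝ) < (T : ℝ)⁻¹ by positivity), Real.log_inv,
    Real.exp_le_exp, neg_le_neg_iff, postSd]
  set m : ℝ := ((cycleCount a j (lastBatchEnd α a (t - 1)) : ℕ) : ℝ)
  have hm0 : 0 ≤ m := Nat.cast_nonneg _
  have e : (Δ / 4 / (σ / √(1 + m))) ^ 2 / 2 = Δ ^ 2 * (1 + m) / (32 * σ ^ 2) := by
    rw [div_pow, div_pow σ, Real.sq_sqrt (by positivity)]
    field_simp
    ring
  rw [e, le_div_iff₀ (by positivity)]
  rw [div_le_iff₀ (by positivity)] at hn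
  nlinarith [mul_le_mul_of_nonneg_right hm (sq_nonneg Δ), sq_nonneg Δ]

end

/-! ### Expected number of pulls of a suboptimal arm -/

section

variable {sel : (Fin K → ℝ) → Fin K} (hsel : IsArgmax sel) (α σ : ℝ)

lemma measurable_inRun (i : Fin K) {t : ℕ} (ht : 1 ≤ t) :
    MeasurableSet {a : ℕ → Fin K | InRun a i t} :=
  measurableSet_setOfPred.2 (measurable_of_dependsOn_le t fun _ _ h =>
    propext (inRun_congr i ht fun s hs => h s hs.le))

/-- An upper bound, up to resampling the noise of time `t`, for the indicator of the event that the
suboptimal arm `i` is played at time `t`; see `noiseLaw_play_le`. The cycle counts are small if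
they are below `L`. -/
noncomputable def playBound (sel : (Fin K → ℝ) → Fin K) (α σ : ℝ) (i b : Fin K) (μi μb n d : ℝ)
    (ε : ℝ≥0∞) (L t : ℕ) (p : (ℕ → Fin K → ℝ) × (ℕ → Fin K → ℝ)) : ℝ≥0∞ :=
  let a := action sel α σ p.1 p.2
  ((if Accurate sel α σ i μi n d t p ∧ Accurate sel α σ b μb n d t p then 0 else 1) + 2 * ε) +
    ((if InRun a b t ∧ cycleCount a b (t - 1) < L then 1 else 0) +
      if ¬ InRun a i t ∧ cycleCount a i (t - 1) < L then 1 else 0) *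
        Set.indicator {i} 1 (a t) +
    (if ¬ InRun a b t ∧ cycleCount a b (t - 1) < L then 2 * cost sel α σ b μb t p ^ 2 else 0) *
        Set.indicator {b} 1 (a t) +
    (if InRun a i t ∧ cycleCount a i (t - 1) < L then 3 * cost sel α σ i μi t p ^ 2 else 0) *
        Set.indicator {i}ᶜ 1 (a t)

include hsel in
lemma measurable_playBound (i b : Fin K) (μi μb n d : ℝ) (ε : ℝ≥0∞) (L : ℕ) {t : ℕ} (ht : 1 ≤ t) :
    Measurable (playBound sel α σ i b μi μb n d ε L t) := by
  have ha := measurable_action hsel α σ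
  have hat : Measurable fun p : (ℕ → Fin K → ℝ) × (ℕ → Fin K → ℝ) => action sel α σ p.1 p.2 t :=
    measurable_pi_iff.1 ha t
  have hind : ∀ S : Set (Fin K), Measurable fun p : (ℕ → Fin K → ℝ) × (ℕ → Fin K → ℝ) =>
      (S.indicator 1 (action sel α σ p.1 p.2 t) : ℝ≥0∞) := fun S =>
    (measurable_of_countable (fun k => (S.indicator 1 k : ℝ≥0∞))).comp hat
  have hr : ∀ j, MeasurableSet {p : (ℕ → Fin K → ℝ) × (ℕ → Fin K → ℝ) |
      InRun (action sel α σ p.1 p.2) j t} := fun j => ha (measurable_inRun j ht)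
  have hc : ∀ j, MeasurableSet {p : (ℕ → Fin K → ℝ) × (ℕ → Fin K → ℝ) |
      cycleCount (action sel α σ p.1 p.2) j (t - 1) < L} := fun j =>
    measurable_cycleCount_action hsel α σ j (t - 1) measurableSet_Iio
  have hcost := fun μ j => (measurable_cost hsel α σ μ t j).pow_const 2
  unfold playBound
  refine Measurable.add (Measurable.add (Measurable.add (Measurable.add ?_ measurable_const)
    (Measurable.mul (Measurable.add ?_ ?_) (hind _))) (Measurable.mul ?_ (hind _)))
    (Measurable.mul ?_ (hind _))
  · exact Measurable.ite ((measurableSet_accurate hsel α σ i μi n d t).inter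
      (measurableSet_accurate hsel α σ b μb n d t)) measurable_const measurable_const
  · exact Measurable.ite ((hr b).inter (hc b)) measurable_const measurable_const
  · exact Measurable.ite ((hr i).compl.inter (hc i)) measurable_const measurable_const
  · exact Measurable.ite ((hr b).compl.inter (hc b)) ((hcost μb b).const_mul _) measurable_const
  · exact Measurable.ite ((hr i).inter (hc i)) ((hcost μi i).const_mul _) measurable_const

lemma action_update_noise_self (y z : ℕ → Fin K → ℝ) {t : ℕ} (ht : 1 ≤ t) (w : Fin K → ℝ) :
    action sel α σ y (Function.update z t w) t =
      sel fun i => postMean α y (action sel α σ y z) t i +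
        postSd α σ (action sel α σ y z) t i * w i := by
  obtain ⟨t, rfl⟩ := Nat.exists_eq_add_of_le' ht
  have h : ∀ s < t + 1, action sel α σ y (Function.update z (t + 1) w) s = action sel α σ y z s :=
    fun s hs => action_update_noise sel α σ y z hs w
  rw [action_succ, sample_eq]
  congr 1
  funext i
  rw [postMean_congr α i ht (fun _ _ => rfl) h, postSd_congr α σ i ht h, Function.update_self]

lemma playBound_update_noise (i b : Fin K) (μi μb n d : ℝ) (ε : ℝ≥0∞) (L : ℕ) {t : ℕ} (ht : 1 ≤ t)
    (p : (ℕ → Fin K → ℝ) × (ℕ → Fin K → ℝ)) (w : Fin K → ℝ) :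
    playBound sel α σ i b μi μb n d ε L t (p.1, Function.update p.2 t w) =
      let a := action sel α σ p.1 p.2
      let k := sel fun i => postMean α p.1 a t i + postSd α σ a t i * w i
      ((if Accurate sel α σ i μi n d t p ∧ Accurate sel α σ b μb n d t p then 0 else 1) + 2 * ε) +
        ((if InRun a b t ∧ cycleCount a b (t - 1) < L then 1 else 0) +
          if ¬ InRun a i t ∧ cycleCount a i (t - 1) < L then 1 else 0) * Set.indicator {i} 1 k +
        (if ¬ InRun a b t ∧ cycleCount a b (t - 1) < L then 2 * cost sel α σ b μb t p ^ 2 else 0) *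
            Set.indicator {b} 1 k +
        (if InRun a i t ∧ cycleCount a i (t - 1) < L then 3 * cost sel α σ i μi t p ^ 2 else 0) *
            Set.indicator {i}ᶜ 1 k := by
  have h : ∀ s < t, action sel α σ p.1 (Function.update p.2 t w) s = action sel α σ p.1 p.2 s :=
    fun s hs => action_update_noise sel α σ p.1 p.2 hs w
  have h' : ∀ s ≤ t - 1, action sel α σ p.1 (Function.update p.2 t w) s =
      action sel α σ p.1 p.2 s := fun s hs => h s (by omega)
  have hl := lastBatchEnd_le α (action sel α σ p.1 p.2) (t - 1)
  have hpm := fun j => postMean_congr α (y := p.1) j ht (fun _ _ => rfl) h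
  have hps := fun j => postSd_congr α σ j ht h
  have hacc : ∀ j μ, Accurate sel α σ j μ n d t (p.1, Function.update p.2 t w) ↔
      Accurate sel α σ j μ n d t p := fun j μ => by
    simp only [Accurate, hpm, lastBatchEnd_congr α _ h',
      cycleCount_congr j _ fun s hs => h' s (hs.trans hl)]
  have hcost : ∀ j μ, cost sel α σ j μ t (p.1, Function.update p.2 t w) =
      cost sel α σ j μ t p := fun j μ => by simp only [cost, hpm, hps]
  have hrun := fun j => inRun_congr j ht h
  have hcc := fun j => cycleCount_congr j (t - 1) h'
  simp only [playBound, hacc, hcost, hrun, hcc, action_update_noise_self α σ p.1 p.2 ht w]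

end

section

variable {sel : (Fin K → ℝ) → Fin K} (hsel : IsArgmax sel)

include hsel in
/-- The indicator of a play of `i` is dominated in expectation by `playBound`. Given the past, the
means and standard deviations of the samples are fixed and `noiseLaw_play_le` applies. -/
lemma lintegral_play_le (ν : ℕ → Measure (Fin K → ℝ)) [∀ t, IsProbabilityMeasure (ν t)]
    {i b : Fin K} (hib : i ≠ b) {α σ μi μb n : ℝ} {L t T : ℕ} (ht : 1 ≤ t) (hT : 2 ≤ T)
    (hα : 1 < α) (hσ : 0 < σ) (hμ : μi < μb)
    (hn : 32 * σ ^ 2 * Real.log T / (μb - μi) ^ 2 ≤ n) (hL : α * n + 1 ≤ L) :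
    ∫⁻ p, Set.indicator {i} 1 (action sel α σ p.1 p.2 t) ∂(jointLaw ν) ≤
      ∫⁻ p, playBound sel α σ i b μi μb n ((μb - μi) / 4) (ENNReal.ofReal (1 / T)) L t p
        ∂(jointLaw ν) := by
  have hind : ∀ S : Set (Fin K), Measurable fun k : Fin K => (S.indicator 1 k : ℝ≥0∞) :=
    fun S => measurable_of_countable _
  have hat : Measurable fun p : (ℕ → Fin K → ℝ) × (ℕ → Fin K → ℝ) => action sel α σ p.1 p.2 t :=
    measurable_pi_iff.1 (measurable_action hsel α σ) t
  have hm : Measurable fun p : (ℕ → Fin K → ℝ) × (ℕ → Fin K → ℝ) =>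
      (Set.indicator {i} 1 (action sel α σ p.1 p.2 t) : ℝ≥0∞) := (hind {i}).comp hat
  rw [lintegral_jointLaw_update_noise ν t hm,
    lintegral_jointLaw_update_noise ν t (measurable_playBound hsel α σ i b μi μb n _ _ L ht)]
  refine lintegral_mono fun p => ?_
  simp only [playBound_update_noise α σ i b μi μb n _ _ L ht,
    action_update_noise_self α σ p.1 p.2 ht]
  set a := action sel α σ p.1 p.2 with ha
  have hk : Measurable fun w : Fin K → ℝ =>
      sel fun i => postMean α p.1 a t i + postSd α σ a t i * w i :=
    hsel.measurable.comp (by fun_prop)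
  have hS : ∀ S : Set (Fin K), ∫⁻ w, S.indicator 1
      (sel fun i => postMean α p.1 a t i + postSd α σ a t i * w i) ∂(noiseLaw K) =
        noiseLaw K {w | (sel fun i => postMean α p.1 a t i + postSd α σ a t i * w i) ∈ S} := by
    intro S
    exact lintegral_indicator_one (hk S.toFinite.measurableSet)
  have hmS : ∀ S : Set (Fin K), Measurable fun w : Fin K → ℝ => (S.indicator 1
      (sel fun i => postMean α p.1 a t i + postSd α σ a t i * w i) : ℝ≥0∞) :=
    fun S => (hind S).comp hk
  rw [lintegral_add_right _ ((hmS _).const_mul _), lintegral_add_right _ ((hmS _).const_mul _),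
    lintegral_add_right _ ((hmS _).const_mul _), lintegral_const_mul _ (hmS _),
    lintegral_const_mul _ (hmS _), lintegral_const_mul _ (hmS _), hS, hS, hS, lintegral_const,
    measure_univ, mul_one]
  have hsd := postSd_pos (α := α) hσ a t
  have hΔ : 0 < μb - μi := sub_pos.2 hμ
  have hmany : ∀ j, ¬ cycleCount a j (t - 1) < L →
      n ≤ (cycleCount a j (lastBatchEnd α a (t - 1)) : ℝ) := by
    intro j hj
    have h1 := cycleCount_le_mul_lastBatchEnd (a := a) hα (t - 1) j
    have h2 : (L : ℝ) ≤ cycleCount a j (t - 1) := by exact_mod_cast not_lt.1 hj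
    have h3 : α * n ≤ α * cycleCount a j (lastBatchEnd α a (t - 1)) := by linarith
    exact le_of_mul_le_mul_left h3 (by linarith)
  refine noiseLaw_play_le hsel (postMean α p.1 a t) (postSd α σ a t) hib (y := (μi + μb) / 2)
    (Accurate sel α σ i μi n ((μb - μi) / 4) t p ∧ Accurate sel α σ b μb n ((μb - μi) / 4) t p)
    (InRun a i t) (InRun a b t) (cycleCount a i (t - 1) < L) (cycleCount a b (t - 1) < L)
    (one_le_invTail _) (one_le_invTail _) (one_le_invTail_mul_gt (hsd b) (by linarith))
    (one_le_invTail_mul_le (hsd i) (by linarith)) ?_ ?_ ?_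
  · intro hgood hi
    have h1 := (abs_le.1 (hgood.1 (hmany i hi))).2
    exact (gaussianReal_gt_le (hsd i) (c := (μb - μi) / 4) (by positivity) (by linarith)).trans
      (exp_neg_postSd_le hσ hΔ hT hn (hmany i hi))
  · intro hgood hb
    have h1 := (abs_le.1 (hgood.2 (hmany b hb))).1
    exact (gaussianReal_le_le (hsd b) (c := (μb - μi) / 4) (by positivity) (by linarith)).trans
      (exp_neg_postSd_le hσ hΔ hT hn (hmany b hb))
  · rw [show (2 : ℝ≥0∞)⁻¹ = ENNReal.ofReal (1 / 2) by
      rw [one_div, ENNReal.ofReal_inv_of_pos (by norm_num)]; simp]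
    refine ENNReal.ofReal_le_ofReal ?_
    gcongr
    exact_mod_cast hT

/-- Summing the charges over time: every recorded play of an arm and every end of a cycle of an
arm happens at its own value of the cycle count of the arm, which `peelSum` controls. -/
lemma sum_playBound_le {i b : Fin K} (hib : i ≠ b) {α σ μi μb n d : ℝ} {ε : ℝ≥0∞} {L T : ℕ}
    (hα : 1 < α) (hσ : 0 < σ) (hασ : α ≤ 5 * σ ^ 2 / 4)
    (hμi : μi ∈ Set.Icc (0 : ℝ) 1) (hμb : μb ∈ Set.Icc (0 : ℝ) 1)
    (p : (ℕ → Fin K → ℝ) × (ℕ → Fin K → ℝ)) :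
    ∑ t ∈ Finset.Icc 1 T, playBound sel α σ i b μi μb n d ε L t p ≤
      ∑ t ∈ Finset.Icc 1 T, ((if Accurate sel α σ i μi n d t p ∧ Accurate sel α σ b μb n d t p
        then 0 else 1) + 2 * ε) + 2 * (L : ℝ≥0∞) +
      2 * ENNReal.ofReal (9 * Real.exp 15) *
        ∑ k ∈ Finset.range L, peelSum sel α σ b μb T (max k 1) p +
      3 * ENNReal.ofReal (9 * Real.exp 15) *
        ∑ k ∈ Finset.range L, peelSum sel α σ i μi T (max k 1) p := by
  set a := action sel α σ p.1 p.2 with ha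
  set C := ENNReal.ofReal (9 * Real.exp 15)
  have hrec : ∀ j, ∀ t t', 1 ≤ t → t < t' → Recorded a j t → Recorded a j t' →
      cycleCount a j (t - 1) < cycleCount a j (t' - 1) := fun j t t' ht htt' h _ =>
    cycleCount_lt_of_recorded ht (by omega) h
  have hrun : ∀ j, ∀ t t', 1 ≤ t → t < t' → RunEnd a j t → RunEnd a j t' →
      cycleCount a j (t - 1) < cycleCount a j (t' - 1) := fun j t t' _ htt' h h' =>
    cycleCount_lt_of_runEnd htt' h h'.1
  have hcost : ∀ j μ, μ ∈ Set.Icc (0 : ℝ) 1 → ∀ t ∈ Finset.Icc 1 T, cost sel α σ j μ t p ^ 2 ≤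
      C * peelSum sel α σ j μ T (max (cycleCount a j (t - 1)) 1) p := fun j μ hμ t ht =>
    cost_sq_le_peelSum j hα hσ hασ hμ (Finset.mem_Icc.1 ht).2 p rfl
  have s1 := sum_le_sum_of_strictMonoOn (T := T) (L := L) (φ := fun _ => 1) (Ψ := fun _ => 1)
    (hrun b) fun _ _ _ => le_rfl
  have s2 := sum_le_sum_of_strictMonoOn (T := T) (L := L) (φ := fun _ => 1) (Ψ := fun _ => 1)
    (hrec i) fun _ _ _ => le_rfl
  have s3 := sum_le_sum_of_strictMonoOn (T := T) (L := L)
    (φ := fun t => 2 * cost sel α σ b μb t p ^ 2)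
    (Ψ := fun k => 2 * C * peelSum sel α σ b μb T (max k 1) p) (hrec b) fun t ht _ => by
      rw [mul_assoc]; exact mul_le_mul_right (hcost b μb hμb t ht) _
  have s4 := sum_le_sum_of_strictMonoOn (T := T) (L := L)
    (φ := fun t => 3 * cost sel α σ i μi t p ^ 2)
    (Ψ := fun k => 3 * C * peelSum sel α σ i μi T (max k 1) p) (hrun i) fun t ht _ => by
      rw [mul_assoc]; exact mul_le_mul_right (hcost i μi hμi t ht) _
  rw [← Finset.mul_sum] at s3 s4
  simp only [Finset.sum_const, Finset.card_range, nsmul_eq_mul, mul_one] at s1 s2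
  rw [two_mul (L : ℝ≥0∞)]
  refine le_trans ?_ (add_le_add (add_le_add (add_le_add le_rfl (add_le_add s1 s2)) s3) s4)
  rw [← Finset.sum_add_distrib, ← Finset.sum_add_distrib, ← Finset.sum_add_distrib,
    ← Finset.sum_add_distrib]
  refine Finset.sum_le_sum fun t ht => ?_
  have ht1 := (Finset.mem_Icc.1 ht).1
  simp only [playBound, ← ha]
  refine add_le_add (add_le_add (add_le_add le_rfl ?_) ?_) ?_
  · by_cases hi : a t = i
    · rw [add_mul, Set.indicator_of_mem (show a t ∈ ({i} : Set (Fin K)) from hi), Pi.one_apply,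
        mul_one, mul_one]
      refine add_le_add ?_ ?_
      · split_ifs with h1 h2
        · exact le_rfl
        · exact absurd ⟨⟨h1.1, by rw [hi]; exact hib⟩, h1.2⟩ h2
        · exact zero_le
        · exact le_rfl
      · split_ifs with h1 h2
        · exact le_rfl
        · exact absurd ⟨recorded_of_not_inRun a i ht1 hi h1.1, h1.2⟩ h2
        · exact zero_le
        · exact le_rfl
    · rw [Set.indicator_of_notMem (show a t ∉ ({i} : Set (Fin K)) from hi), mul_zero]
      exact zero_le
  · by_cases hb : a t = b
    · rw [Set.indicator_of_mem (show a t ∈ ({b} : Set (Fin K)) from hb), Pi.one_apply, mul_one]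
      split_ifs with h1 h2
      · exact le_rfl
      · exact absurd ⟨recorded_of_not_inRun a b ht1 hb h1.1, h1.2⟩ h2
      · exact zero_le
      · exact le_rfl
    · rw [Set.indicator_of_notMem (show a t ∉ ({b} : Set (Fin K)) from hb), mul_zero]
      exact zero_le
  · by_cases hi : a t = i
    · rw [Set.indicator_of_notMem (show a t ∉ ({i}ᶜ : Set (Fin K)) from fun h => h hi), mul_zero]
      exact zero_le
    · rw [Set.indicator_of_mem (show a t ∈ ({i}ᶜ : Set (Fin K)) from hi), Pi.one_apply, mul_one]
      split_ifs with h1 h2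
      · exact le_rfl
      · exact absurd ⟨⟨h1.1, hi⟩, h1.2⟩ h2
      · exact zero_le
      · exact le_rfl

include hsel in
/-- The bound on the expected number of pulls, in terms of a number `n` of recorded rewards that
makes both arms well explored and a cycle count `L` that guarantees `n` rewards at the last batch
end point. -/
lemma lintegral_pulls_le (ν : ℕ → Measure (Fin K → ℝ)) [∀ t, IsProbabilityMeasure (ν t)]
    {i b : Fin K} (hib : i ≠ b) {α σ μi μb n : ℝ} {L T : ℕ} (hT : 2 ≤ T)
    (hα : 1 < α) (hσ : 0 < σ) (hασ : α ≤ 5 * σ ^ 2 / 4)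
    (hμi : μi ∈ Set.Icc (0 : ℝ) 1) (hμb : μb ∈ Set.Icc (0 : ℝ) 1) (hμ : μi < μb)
    (hνi : ∀ t l, ∫⁻ v, ENNReal.ofReal (Real.exp (l * (v i - μi) - l ^ 2 / 8)) ∂(ν t) ≤ 1)
    (hνb : ∀ t l, ∫⁻ v, ENNReal.ofReal (Real.exp (l * (v b - μb) - l ^ 2 / 8)) ∂(ν t) ≤ 1)
    (hn : 120 * σ ^ 2 * Real.log T / (μb - μi) ^ 2 ≤ n) (hL : α * n + 1 ≤ L) :
    ∫⁻ p, (pulls (action sel α σ p.1 p.2) i T : ℝ≥0∞) ∂(jointLaw ν) ≤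
      5 + (2 + 300 * ENNReal.ofReal (9 * Real.exp 15)) * (L : ℝ≥0∞) := by
  have hΔ : 0 < μb - μi := sub_pos.2 hμ
  have hΔ1 : μb - μi ≤ 1 := by linarith [hμi.1, hμb.2]
  have hT0 : (0 : ℝ) < T := by positivity
  have hlog : 0 ≤ Real.log T := Real.log_natCast_nonneg T
  have hn1 : 32 * σ ^ 2 * Real.log T / (μb - μi) ^ 2 ≤ n := by
    refine le_trans ?_ hn
    gcongr
    norm_num
  have hn2 : 96 * Real.log T / (μb - μi) ^ 2 ≤ n := by
    refine le_trans ?_ hn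
    gcongr
    nlinarith
  set C := ENNReal.ofReal (9 * Real.exp 15)
  have hind : ∀ S : Set (Fin K), Measurable fun k : Fin K => (S.indicator 1 k : ℝ≥0∞) :=
    fun S => measurable_of_countable _
  have hat : ∀ t, Measurable fun p : (ℕ → Fin K → ℝ) × (ℕ → Fin K → ℝ) =>
      action sel α σ p.1 p.2 t := measurable_pi_iff.1 (measurable_action hsel α σ)
  have hpulls : ∀ p : (ℕ → Fin K → ℝ) × (ℕ → Fin K → ℝ),
      (pulls (action sel α σ p.1 p.2) i T : ℝ≥0∞) =
        ∑ t ∈ Finset.Icc 1 T, Set.indicator {i} 1 (action sel α σ p.1 p.2 t) := by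
    intro p
    rw [pulls, Finset.card_filter, Nat.cast_sum]
    refine Finset.sum_congr rfl fun t _ => ?_
    simp [Set.indicator]
  have hmacc : ∀ t, MeasurableSet {p | Accurate sel α σ i μi n ((μb - μi) / 4) t p ∧
      Accurate sel α σ b μb n ((μb - μi) / 4) t p} := fun t =>
    (measurableSet_accurate hsel α σ i μi n _ t).inter (measurableSet_accurate hsel α σ b μb n _ t)
  have hmc0 : ∀ t, Measurable fun p : (ℕ → Fin K → ℝ) × (ℕ → Fin K → ℝ) =>
      ((if Accurate sel α σ i μi n ((μb - μi) / 4) t p ∧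
        Accurate sel α σ b μb n ((μb - μi) / 4) t p then 0 else 1 : ℝ≥0∞)) := fun t =>
    Measurable.ite (hmacc t) measurable_const measurable_const
  have hpeel : ∀ j μ, (∀ t l, ∫⁻ v, ENNReal.ofReal
      (Real.exp (l * (v j - μ) - l ^ 2 / 8)) ∂(ν t) ≤ 1) →
      ∫⁻ p, ∑ k ∈ Finset.range L, peelSum sel α σ j μ T (max k 1) p ∂(jointLaw ν) ≤ L * 60 := by
    intro j μ h
    rw [lintegral_finsetSum _ fun k _ => measurable_peelSum hsel α σ j μ T _]
    refine (Finset.sum_le_sum fun k _ =>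
      lintegral_peelSum_le hsel α σ j μ ν h T (le_max_right k 1)).trans_eq ?_
    simp
  have hc0 : ∀ t ∈ Finset.Icc 1 T, ∫⁻ p, ((if Accurate sel α σ i μi n ((μb - μi) / 4) t p ∧
      Accurate sel α σ b μb n ((μb - μi) / 4) t p then 0 else 1) +
        2 * ENNReal.ofReal (1 / T)) ∂(jointLaw ν) ≤ ENNReal.ofReal (5 / T) := by
    intro t ht
    have htT := (Finset.mem_Icc.1 ht).2
    rw [lintegral_add_left (hmc0 t), lintegral_const, measure_univ, mul_one]
    have h1 : ∫⁻ p, (if Accurate sel α σ i μi n ((μb - μi) / 4) t p ∧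
        Accurate sel α σ b μb n ((μb - μi) / 4) t p then 0 else 1) ∂(jointLaw ν) ≤
          ENNReal.ofReal (2 * (T + 1) / T ^ 3) + ENNReal.ofReal (2 * (T + 1) / T ^ 3) := by
      calc _ = jointLaw ν {p | ¬ (Accurate sel α σ i μi n ((μb - μi) / 4) t p ∧
              Accurate sel α σ b μb n ((μb - μi) / 4) t p)} := by
            refine Eq.trans ?_ (lintegral_indicator_one (hmacc t).compl)
            refine lintegral_congr fun p => ?_
            by_cases h : Accurate sel α σ i μi n ((μb - μi) / 4) t p ∧
              Accurate sel α σ b μb n ((μb - μi) / 4) t p <;> simp [Set.indicator, h]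
        _ ≤ jointLaw ν ({p | ¬ Accurate sel α σ i μi n ((μb - μi) / 4) t p} ∪
              {p | ¬ Accurate sel α σ b μb n ((μb - μi) / 4) t p}) :=
            measure_mono fun p hp => not_and_or.1 hp
        _ ≤ _ := (measure_union_le _ _).trans (add_le_add
            (jointLaw_not_accurate_le hsel ν hμi hνi htT hT hΔ hΔ1 hn2)
            (jointLaw_not_accurate_le hsel ν hμb hνb htT hT hΔ hΔ1 hn2))
    refine (add_le_add h1 le_rfl).trans ?_
    rw [show (2 : ℝ≥0∞) = ENNReal.ofReal 2 by simp, ← ENNReal.ofReal_mul (by norm_num),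
      ← ENNReal.ofReal_add (by positivity) (by positivity),
      ← ENNReal.ofReal_add (by positivity) (by positivity)]
    refine ENNReal.ofReal_le_ofReal ?_
    have hT2 : (2 : ℝ) ≤ T := by exact_mod_cast hT
    have e : 5 / (T : ℝ) - (2 * (T + 1) / T ^ 3 + 2 * (T + 1) / T ^ 3 + 2 * (1 / T)) =
        (3 * T ^ 2 - 4 * (T + 1)) / T ^ 3 := by field_simp; ring
    have : 0 ≤ (3 * (T : ℝ) ^ 2 - 4 * (T + 1)) / T ^ 3 := div_nonneg (by nlinarith) (by positivity)
    linarith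
  calc ∫⁻ p, (pulls (action sel α σ p.1 p.2) i T : ℝ≥0∞) ∂(jointLaw ν)
      = ∑ t ∈ Finset.Icc 1 T,
          ∫⁻ p, Set.indicator {i} 1 (action sel α σ p.1 p.2 t) ∂(jointLaw ν) := by
        simp_rw [hpulls]
        exact lintegral_finsetSum _ fun t _ => (hind {i}).comp (hat t)
    _ ≤ ∑ t ∈ Finset.Icc 1 T, ∫⁻ p, playBound sel α σ i b μi μb n ((μb - μi) / 4)
          (ENNReal.ofReal (1 / T)) L t p ∂(jointLaw ν) :=
        Finset.sum_le_sum fun t ht =>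
          lintegral_play_le hsel ν hib (Finset.mem_Icc.1 ht).1 hT hα hσ hμ hn1 hL
    _ = ∫⁻ p, ∑ t ∈ Finset.Icc 1 T, playBound sel α σ i b μi μb n ((μb - μi) / 4)
          (ENNReal.ofReal (1 / T)) L t p ∂(jointLaw ν) :=
        (lintegral_finsetSum _ fun t ht => measurable_playBound hsel α σ i b μi μb n _ _ L
          (Finset.mem_Icc.1 ht).1).symm
    _ ≤ ∫⁻ p, (∑ t ∈ Finset.Icc 1 T, ((if Accurate sel α σ i μi n ((μb - μi) / 4) t p ∧
          Accurate sel α σ b μb n ((μb - μi) / 4) t p then 0 else 1) +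
            2 * ENNReal.ofReal (1 / T)) + 2 * (L : ℝ≥0∞) +
          2 * C * ∑ k ∈ Finset.range L, peelSum sel α σ b μb T (max k 1) p +
          3 * C * ∑ k ∈ Finset.range L, peelSum sel α σ i μi T (max k 1) p) ∂(jointLaw ν) :=
        lintegral_mono fun p => sum_playBound_le hib hα hσ hασ hμi hμb p
    _ ≤ 5 + 2 * (L : ℝ≥0∞) + 2 * C * (L * 60) + 3 * C * (L * 60) := by
        have hm : ∀ j μ, Measurable fun p => ∑ k ∈ Finset.range L,
            peelSum sel α σ j μ T (max k 1) p := fun j μ =>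
          Finset.measurable_sum _ fun k _ => measurable_peelSum hsel α σ j μ T _
        rw [lintegral_add_right _ ((hm i μi).const_mul _),
          lintegral_add_right _ ((hm b μb).const_mul _), lintegral_add_right _ measurable_const,
          lintegral_const_mul _ (hm i μi), lintegral_const_mul _ (hm b μb), lintegral_const,
          measure_univ, mul_one, lintegral_finsetSum _ fun t _ => (hmc0 t).add_const _]
        gcongr
        · refine (Finset.sum_le_sum hc0).trans ?_
          rw [Finset.sum_const, Nat.card_Icc, Nat.add_sub_cancel, nsmul_eq_mul,
            ← ENNReal.ofReal_natCast, ← ENNReal.ofReal_mul hT0.le, mul_div_cancel₀ _ hT0.ne']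
          simp
        · exact hpeel b μb hνb
        · exact hpeel i μi hνi
    _ = _ := by ring

end

/-! ### Regret of Batched Thompson sampling -/

section

variable {Ω : Type*} [MeasurableSpace Ω] {P : Measure Ω}
  {Y Z : ℕ → Fin K → Ω → ℝ}

lemma mean_mem_Icc [IsProbabilityMeasure P] (hY : IsBandit P Y) (j : Fin K) :
    mean P Y j ∈ Set.Icc (0 : ℝ) 1 := by
  have hint : Integrable (Y 1 j) P :=
    Integrable.of_mem_Icc 0 1 (hY.measurable 1 j).aemeasurable (hY.mem_Icc 1 j)
  refine ⟨integral_nonneg_of_ae ((hY.mem_Icc 1 j).mono fun ω h => h.1), ?_⟩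
  refine (integral_mono_ae hint (integrable_const 1)
    ((hY.mem_Icc 1 j).mono fun ω h => h.2)).trans_eq ?_
  simp

/-- Hoeffding's lemma for the rewards, in terms of the law of a reward vector. -/
lemma lintegral_exp_reward_le [IsProbabilityMeasure P] (hY : IsBandit P Y) (j : Fin K)
    (t : ℕ) (l : ℝ) :
    ∫⁻ v, ENNReal.ofReal (Real.exp (l * (v j - mean P Y j) - l ^ 2 / 8))
      ∂(P.map fun ω i => Y t i ω) ≤ 1 := by
  have hmY : Measurable fun ω => (fun i => Y t i ω : Fin K → ℝ) :=
    measurable_pi_iff.2 fun i => hY.measurable t i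
  have hmean : mean P Y j = ∫ ω, Y t j ω ∂P := (hY.identDistrib j 1 t).integral_eq
  have h := hasSubgaussianMGF_of_mem_Icc (hY.measurable t j).aemeasurable (hY.mem_Icc t j)
  have hint := (h.integrable_exp_mul l).mul_const (Real.exp (-(l ^ 2 / 8)))
  have hle := h.mgf_le l
  rw [← hmean] at hint hle
  rw [lintegral_map (by fun_prop) hmY]
  have e : ∀ ω, Real.exp (l * (Y t j ω - mean P Y j) - l ^ 2 / 8) =
      Real.exp (l * (Y t j ω - mean P Y j)) * Real.exp (-(l ^ 2 / 8)) := fun ω => by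
    rw [← Real.exp_add]; congr 1
  simp_rw [e]
  rw [← ofReal_integral_eq_lintegral_ofReal hint
    (ae_of_all _ fun ω => (mul_pos (Real.exp_pos _) (Real.exp_pos _)).le), ENNReal.ofReal_le_one,
    integral_mul_const]
  calc _ ≤ Real.exp (l ^ 2 / 8) * Real.exp (-(l ^ 2 / 8)) := by
        refine mul_le_mul_of_nonneg_right (hle.trans_eq ?_) (Real.exp_pos _).le
        congr 1
        simp
        ring
    _ = 1 := by rw [← Real.exp_add]; simp

lemma pulls_congr {a b : ℕ → Fin K} (i : Fin K) (T : ℕ) (h : ∀ s ≤ T, a s = b s) :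
    pulls a i T = pulls b i T := by
  unfold pulls
  congr 1
  exact Finset.filter_congr fun s hs => by rw [h s (Finset.mem_Icc.1 hs).2]

lemma measurable_pulls {sel : (Fin K → ℝ) → Fin K} (hsel : IsArgmax sel) (α σ : ℝ) (i : Fin K)
    (T : ℕ) : Measurable fun p : (ℕ → Fin K → ℝ) × (ℕ → Fin K → ℝ) =>
      pulls (action sel α σ p.1 p.2) i T :=
  (measurable_of_dependsOn_le T fun _ _ h => pulls_congr i T h).comp (measurable_action hsel α σ)

lemma sum_pulls (a : ℕ → Fin K) (T : ℕ) : ∑ i, pulls a i T = T := by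
  have := Finset.card_eq_sum_card_fiberwise (s := Finset.Icc 1 T) (t := Finset.univ) (f := a)
    fun _ _ => Finset.mem_coe.2 (Finset.mem_univ _)
  rw [Nat.card_Icc, Nat.add_sub_cancel] at this
  exact this.symm

lemma measurable_tables (hY : IsBandit P Y) (hZ : IsSamplingNoise P Y Z) :
    Measurable fun ω => ((fun t i => Y t i ω, fun t i => Z t i ω) :
      (ℕ → Fin K → ℝ) × (ℕ → Fin K → ℝ)) :=
  (measurable_pi_iff.2 fun t => measurable_pi_iff.2 fun i => hY.measurable t i).prodMk
    (measurable_pi_iff.2 fun t => measurable_pi_iff.2 fun i => hZ.measurable t i)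

lemma integrable_pulls [IsProbabilityMeasure P] (hY : IsBandit P Y) (hZ : IsSamplingNoise P Y Z)
    {sel : (Fin K → ℝ) → Fin K} (hsel : IsArgmax sel) (α σ : ℝ) (i : Fin K) (T : ℕ) :
    Integrable (fun ω => (pulls (action sel α σ (fun t j => Y t j ω) (fun t j => Z t j ω)) i T : ℝ))
      P := by
  refine Integrable.of_mem_Icc 0 T ?_ (ae_of_all _ fun ω => ⟨Nat.cast_nonneg _, ?_⟩)
  · exact ((measurable_of_countable fun n : ℕ => (n : ℝ)).comp
      ((measurable_pulls hsel α σ i T).comp (measurable_tables hY hZ))).aemeasurable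
  · refine Nat.cast_le.2 ((Finset.card_filter_le _ _).trans_eq ?_)
    simp

lemma expectedPulls_nonneg (sel : (Fin K → ℝ) → Fin K) (α σ : ℝ) (i : Fin K) (T : ℕ) :
    0 ≤ expectedPulls P Y Z sel α σ i T :=
  integral_nonneg fun _ => Nat.cast_nonneg _

lemma sum_expectedPulls [IsProbabilityMeasure P] (hY : IsBandit P Y) (hZ : IsSamplingNoise P Y Z)
    {sel : (Fin K → ℝ) → Fin K} (hsel : IsArgmax sel) (α σ : ℝ) (T : ℕ) :
    ∑ i, expectedPulls P Y Z sel α σ i T = T := by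
  simp only [expectedPulls]
  rw [← integral_finsetSum _ fun i _ => integrable_pulls hY hZ hsel α σ i T]
  have : ∀ ω, ∑ i, (pulls (action sel α σ (fun t j => Y t j ω) (fun t j => Z t j ω)) i T : ℝ) =
      T := fun ω => by exact_mod_cast sum_pulls _ T
  simp [this]

/-- The constant in the bound on the expected number of pulls. -/
noncomputable def pullsConst : ℝ := 10 + (2 + 300 * (9 * Real.exp 15)) * 124

lemma expectedPulls_le [IsProbabilityMeasure P] (hY : IsBandit P Y) (hZ : IsSamplingNoise P Y Z)
    {sel : (Fin K → ℝ) → Fin K} (hsel : IsArgmax sel) {α σ : ℝ} {i b : Fin K} {T : ℕ}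
    (hi : mean P Y i < mean P Y b) (hα : 1 < α) (hσ : 0 < σ) (hασ : α ≤ 5 * σ ^ 2 / 4)
    (hT : 2 ≤ T) :
    expectedPulls P Y Z sel α σ i T ≤
      pullsConst * α * σ ^ 2 * (Real.log T / gap P Y b i ^ 2) := by
  have hprob : ∀ t, IsProbabilityMeasure (P.map fun ω i => Y t i ω) := fun t =>
    Measure.isProbabilityMeasure_map
      (measurable_pi_iff.2 fun i => hY.measurable t i).aemeasurable
  have hlog : 69 / 100 < Real.log T := by
    have h1 := Real.log_two_gt_d9
    have h2 := Real.log_le_log (by norm_num) (show (2 : ℝ) ≤ T by exact_mod_cast hT)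
    linarith
  have hΔ : 0 < gap P Y b i := sub_pos.2 hi
  have hμi := mean_mem_Icc hY i
  have hμb := mean_mem_Icc hY b
  have hΔ1 : gap P Y b i ≤ 1 := by unfold gap; linarith [hμi.1, hμb.2]
  set q : ℝ := α * σ ^ 2 * (Real.log T / gap P Y b i ^ 2) with hq
  -- `α σ²` is bounded below because `σ² ≥ 4 α / 5 > 4 / 5`, so `q` absorbs additive constants.
  have hq1 : 1 / 2 ≤ q := by
    have hσ2 : 1 ≤ 5 / 4 * σ ^ 2 := by linarith
    have : 1 ≤ α * σ ^ 2 * (5 / 4) := by nlinarith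
    have h3 : 69 / 100 ≤ Real.log T / gap P Y b i ^ 2 := by
      rw [le_div_iff₀ (by positivity)]
      nlinarith
    nlinarith
  -- Enough recorded rewards for accurate posterior means and for Gaussian tails below `1 / T`.
  set n : ℝ := 120 * σ ^ 2 * Real.log T / gap P Y b i ^ 2 with hn
  have hαn : α * n = 120 * q := by rw [hn, hq]; ring
  set L : ℕ := ⌈α * n⌉₊ + 1 with hL
  have hL1 : α * n + 1 ≤ L := by
    rw [hL, Nat.cast_add, Nat.cast_one]
    linarith [Nat.le_ceil (α * n)]
  have hL2 : (L : ℝ) ≤ 124 * q := by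
    rw [hL, Nat.cast_add, Nat.cast_one]
    linarith [Nat.ceil_lt_add_one (show 0 ≤ α * n by rw [hαn]; linarith)]
  have key := lintegral_pulls_le hsel (fun t => P.map fun ω i => Y t i ω)
    (i := i) (b := b) (fun h => by rw [h] at hi; exact lt_irrefl _ hi) hT hα hσ hασ hμi hμb hi
    (lintegral_exp_reward_le hY i) (lintegral_exp_reward_le hY b) hn.ge hL1
  have hmp := measurable_pulls hsel α σ i T
  have hmp' : Measurable fun p : (ℕ → Fin K → ℝ) × (ℕ → Fin K → ℝ) =>
      (pulls (action sel α σ p.1 p.2) i T : ℝ≥0∞) :=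
    (measurable_of_countable fun n : ℕ => (n : ℝ≥0∞)).comp hmp
  rw [← map_tables_eq_jointLaw hY hZ, lintegral_map hmp' (measurable_tables hY hZ)] at key
  have hR : pullsConst * α * σ ^ 2 * (Real.log T / gap P Y b i ^ 2) = pullsConst * q := by
    rw [hq]; ring
  have hC : (0 : ℝ) ≤ 2 + 300 * (9 * Real.exp 15) := by positivity
  rw [hR, expectedPulls, integral_eq_lintegral_of_nonneg_ae
    (ae_of_all _ fun _ => Nat.cast_nonneg _) (integrable_pulls hY hZ hsel α σ i T).1]
  refine ENNReal.toReal_le_of_le_ofReal ?_ ?_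
  · unfold pullsConst; positivity
  simp only [ENNReal.ofReal_natCast]
  refine key.trans ?_
  have e : (5 + (2 + 300 * ENNReal.ofReal (9 * Real.exp 15)) * (L : ℝ≥0∞)) =
      ENNReal.ofReal (5 + (2 + 300 * (9 * Real.exp 15)) * L) := by
    rw [ENNReal.ofReal_add (by norm_num) (by positivity), ENNReal.ofReal_mul hC,
      ENNReal.ofReal_add (by norm_num) (by positivity), ENNReal.ofReal_mul (p := 300) (by norm_num)]
    simp
  rw [e]
  refine ENNReal.ofReal_le_ofReal ?_
  unfold pullsConst
  nlinarith [mul_le_mul_of_nonneg_left hL2 hC]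

end

end BatchedTS

theorem theorem1 :
    ∃ C₁ C₂ : ℝ, 1 ≤ C₁ ∧ 1 ≤ C₂ ∧
      ∀ (Ω : Type*) [MeasurableSpace Ω] (P : Measure Ω) [IsProbabilityMeasure P]
        (K : ℕ) (Y Z : ℕ → Fin K → Ω → ℝ) (sel : (Fin K → ℝ) → Fin K) (best : Fin K)
        (α σ : ℝ) (T : ℕ),
        BatchedTS.IsBandit P Y →
        BatchedTS.IsSamplingNoise P Y Z →
        BatchedTS.IsArgmax sel →
        (∀ i, i ≠ best → BatchedTS.mean P Y i < BatchedTS.mean P Y best) →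
        1 < α → 0 < σ → α ≤ 5 * σ ^ 2 / 4 → 2 ≤ T →
        (∀ i, i ≠ best →
          BatchedTS.expectedPulls P Y Z sel α σ i T ≤
            C₁ * α * σ ^ 2 * (Real.log T / BatchedTS.gap P Y best i ^ 2)) ∧
        BatchedTS.expectedRegret P Y Z sel α σ best T ≤
          C₁ * α * σ ^ 2 *
            ∑ i ∈ Finset.univ.erase best, Real.log T / BatchedTS.gap P Y best i ∧
        BatchedTS.expectedRegret P Y Z sel α σ best T ≤
          C₂ * σ * √(α * K * T * Real.log T) := by
  have hC : 1 ≤ BatchedTS.pullsConst := by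
    have := Real.exp_pos 15
    unfold BatchedTS.pullsConst
    linarith
  refine ⟨BatchedTS.pullsConst, √BatchedTS.pullsConst, hC, Real.one_le_sqrt.2 hC, ?_⟩
  intro Ω _ P _ K Y Z sel best α σ T hY hZ hsel hbest hα hσ hασ hT
  set C := BatchedTS.pullsConst
  have hpulls : ∀ i, i ≠ best → BatchedTS.expectedPulls P Y Z sel α σ i T ≤
      C * α * σ ^ 2 * (Real.log T / BatchedTS.gap P Y best i ^ 2) := fun i hi =>
    BatchedTS.expectedPulls_le hY hZ hsel (hbest i hi) hα hσ hασ hT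
  have hgap : ∀ i, i ≠ best → 0 < BatchedTS.gap P Y best i := fun i hi => sub_pos.2 (hbest i hi)
  have hlog : 0 ≤ Real.log T := Real.log_natCast_nonneg T
  have hα0 : 0 < α := by linarith
  have hC0 : 0 ≤ C := by linarith
  refine ⟨hpulls, ?_, ?_⟩
  · rw [BatchedTS.expectedRegret, Finset.mul_sum]
    refine Finset.sum_le_sum fun i hi => ?_
    have hne := Finset.ne_of_mem_erase hi
    have hg := hgap i hne
    refine (mul_le_mul_of_nonneg_left (hpulls i hne) hg.le).trans_eq ?_
    field_simp
  · have hN0 := fun i => BatchedTS.expectedPulls_nonneg (P := P) (Y := Y) (Z := Z) sel α σ i T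
    -- The geometric mean of the bound on the pulls of arm `i` and the pulls themselves.
    have hterm : ∀ i ∈ Finset.univ.erase best,
        BatchedTS.gap P Y best i * BatchedTS.expectedPulls P Y Z sel α σ i T ≤
          √(C * α * σ ^ 2 * Real.log T) * √(BatchedTS.expectedPulls P Y Z sel α σ i T) := by
      intro i hi
      have hne := Finset.ne_of_mem_erase hi
      have hg := hgap i hne
      rw [← Real.sqrt_mul (by positivity)]
      refine Real.le_sqrt_of_sq_le ?_
      have h := mul_le_mul_of_nonneg_left (hpulls i hne) (sq_nonneg (BatchedTS.gap P Y best i))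
      have e : BatchedTS.gap P Y best i ^ 2 *
          (C * α * σ ^ 2 * (Real.log T / BatchedTS.gap P Y best i ^ 2)) =
          C * α * σ ^ 2 * Real.log T := by field_simp
      rw [e] at h
      calc _ = BatchedTS.gap P Y best i ^ 2 * BatchedTS.expectedPulls P Y Z sel α σ i T *
            BatchedTS.expectedPulls P Y Z sel α σ i T := by ring
        _ ≤ _ := mul_le_mul_of_nonneg_right h (hN0 i)
    have hsum : ∑ i ∈ Finset.univ.erase best, √(BatchedTS.expectedPulls P Y Z sel α σ i T) ≤
        √(K * T) := by
      refine (Finset.sum_le_sum_of_subset_of_nonneg (Finset.erase_subset _ _)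
        fun _ _ _ => Real.sqrt_nonneg _).trans (Real.le_sqrt_of_sq_le ?_)
      refine sq_sum_le_card_mul_sum_sq.trans_eq ?_
      simp only [Real.sq_sqrt (hN0 _), BatchedTS.sum_expectedPulls hY hZ hsel α σ T,
        Finset.card_univ, Fintype.card_fin]
    calc BatchedTS.expectedRegret P Y Z sel α σ best T
        ≤ ∑ i ∈ Finset.univ.erase best, √(C * α * σ ^ 2 * Real.log T) *
            √(BatchedTS.expectedPulls P Y Z sel α σ i T) := Finset.sum_le_sum hterm
      _ ≤ √(C * α * σ ^ 2 * Real.log T) * √(K * T) := by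
          rw [← Finset.mul_sum]
          exact mul_le_mul_of_nonneg_left hsum (Real.sqrt_nonneg _)
      _ = √C * σ * √(α * K * T * Real.log T) := by
          rw [← Real.sqrt_mul (by positivity),
            show C * α * σ ^ 2 * Real.log T * (K * T) = C * (σ ^ 2 * (α * K * T * Real.log T)) by ring,
            Real.sqrt_mul hC0, Real.sqrt_mul (sq_nonneg σ), Real.sqrt_sq hσ.le, ← mul_assoc (√C)]
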